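/- All Hilbert spaces are finite dimensional and $\log$ is to base $2$. For states $\rho,\sigma$ let $F(\rho,\sigma)=\|\sqrt\rho\sqrt\sigma\|_1$, $P(\rho,\sigma)=\sqrt{1-F(\rho,\sigma)^2}$, $D_{\max}(\rho\|\sigma)=\inf\{\lambda\in\mathbb R:\rho\le 2^\lambda\sigma\}\in(-\infty,\infty]$ and $D^{\varepsilon}_{\max}(\rho\|\sigma)=\inf\{D_{\max}(\rho'\|\sigma):\rho'\text{ a state},\,P(\rho,\rho')\le\varepsilon\}$. **Resource theory.** Let $t\ge 1$ parties share registers; a register is a Hilbert space that is a tensor product of $t$ local parts, the $i$-th one held by party $i$. A *framework* is an ordered list of registers $M_1,\dots,M_r$ ($r\ge 2$) with Hilbert spaces $\mathcal H_1,\dots,\mathcal H_r$, chosen by the parties; registers of the same kind may occur repeatedly, and the last register $J_1\cdots J_t$ has $t$ local parts of a common dimension $|J|\ge1$, each with a canonical basis $\{|k\rangle\}_{k=1}^{|J|}$. A *resource theory* gives in every framework, for each non-empty $L\subseteq\{1,\dots,r\}$, a set $\mathcal F_L$ of (free) states on $\bigotimes_{s\in L}\mathcal H_s$ such that (a) $\mathcal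 F_L$ is convex and closed; (b) $\mathcal F_{L'}\otimes\mathcal F_{L\setminus L'}\subseteq\mathcal F_L$ for non-empty $L'\subsetneq L$; (c) $\mathrm{Tr}_{L'}\,\mathcal F_L\subseteq\mathcal F_{L\setminus L'}$ for $L'\subsetneq L$; and, for $j<r$, $\mathcal F_{\{j\}}$ depends only on the kind of the register $M_j$. The set of free states of a single register $M$ is written $\mathcal F_M$. The set $\mathcal U_L$ of free operations consists of the unitaries $U$ with $U\mathcal F_LU^\dagger\subseteq\mathcal F_L$ and $U^\dagger\mathcal F_LU\subseteq\mathcal F_L$. **Assumption 2** (for a framework). With $\ell=|J|$ and $|k^t\rangle=|k\rangle\otimes\cdots\otimes|k\rangle$ on $J_1\cdots J_t$, $$\mathcal F_{\{1,\dots,r\}}=\mathrm{conv}\Big\{\tfrac1\ell\sum_{k=1}^{\ell}U_k\sigma U_k^\dagger\otimes|k^t\rangle\langle k^t| : \sigma\in\mathcal F_{\{1,\dots,r-1\}},\ U_k\in\mathcal U_{\{1,\dots,r-1\}}\Big\};$$ the parties only perform operations that act as $\sum_kU_k\otimes|k^t\rangle\langle k^t|$ with $U_k\in\mathcal U_{\{1,\dots,r-1\}}$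 on the subspace where the last register is in the span of the $|k^t\rangle$; and if $\mathcal H_j=\mathcal H_1$ and $\mathcal F_{\{j\}}=\mathcal F_{\{1\}}$ for all $j<r$, then $\mathcal F_{\{1,\dots,r\}}$ is invariant under the interchange of the registers $1$ and $j$ for every $j<r$. **Task.** Let $\rho$ be a state on a register $M$. An $(\varepsilon,\log|J|,t)$-*transformation* of $\rho$ consists of a framework with first register $M$, last register $J_1\cdots J_t$ and remaining registers $E=M_2\cdots M_{r-1}$, a free state $\mu_{EJ_1\cdots J_t}$, an allowed free operation $U\in\mathcal U_{\{1,\dots,r\}}$ and a free state $\sigma_{ME}$ such that $\Theta=U(\rho\otimes\mu)U^\dagger$ satisfies $P(\Theta_{ME},\sigma_{ME})\le\varepsilon$. It is *catalytic* if $\mu=\mu_E\otimes\mu_{J_1\cdots J_t}$ and $\sigma_{ME}=\sigma_M\otimes\mu_E$ for some $\sigma_M\in\mathcal F_M$. **Theorem.** Let $\varepsilon,\delta>0$, let $\rho$ be a state on a $t$-partite register $M$, and let $k=\min_{\sigma\in\mathcal F_M}D^\varepsilon_{\max}(\rho\|\sigma)\in[0,\infty]$; the minimum is attained if $\mathcal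 F_M\neq\emptyset$, and $k=\infty$ if $\mathcal F_M=\emptyset$. 1. (Achievability) Suppose that Assumption 2 holds in every framework with first register $M$, that $k<\infty$ and that $k+2\log\frac1\delta\ge0$ (for instance $\delta\le1$). Then there is an $(\varepsilon+\delta,k+2\log\frac1\delta,t)$-catalytic transformation of $\rho$, where the dimension $|J|$ is rounded down to an integer: $|J|=\lfloor 2^{k+2\log(1/\delta)}\rfloor=\lfloor 2^k/\delta^2\rfloor$. 2. (Converse) Every $(\varepsilon,\log|J|,t)$-transformation of $\rho$ in a framework in which Assumption 2 holds satisfies $\log|J|\ge k$. (In particular there is none if $k=\infty$.) -/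

import Mathlib

open scoped MatrixOrder ComplexOrder

universe u

noncomputable section

namespace CatalyticResource

/-! ### States, fidelity, purified distance, max-relative entropy -/

/-- Density matrices: positive semidefinite of trace one. -/
def IsState {n : Type*} [Fintype n] (A : Matrix n n ℂ) : Prop :=
  A.PosSemidef ∧ A.trace = 1

/-- The trace norm `‖A‖₁ = Tr √(A† A)`. -/
def traceNorm {n : Type*} [Fintype n] [DecidableEq n] (A : Matrix n n ℂ) : ℝ :=
  (CFC.sqrt (A.conjTranspose * A)).trace.re

/-- The fidelity `F(ρ, σ) = ‖√ρ √σ‖₁`. -/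
def fidelity {n : Type*} [Fintype n] [DecidableEq n] (ρ σ : Matrix n n ℂ) : ℝ :=
  traceNorm (CFC.sqrt ρ * CFC.sqrt σ)

/-- The purified distance `P(ρ, σ) = √(1 - F(ρ, σ)²)`. -/
def purifiedDist {n : Type*} [Fintype n] [DecidableEq n] (ρ σ : Matrix n n ℂ) : ℝ :=
  Real.sqrt (1 - fidelity ρ σ ^ 2)

/-- `D_max(ρ‖σ) = inf {c ∈ ℝ : ρ ≤ 2^c σ}`, which is `⊤` if there is no such `c`. -/
def dmax {n : Type*} [Fintype n] (ρ σ : Matrix n n ℂ) : EReal :=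
  ⨅ (c : ℝ) (_ : (((2 : ℝ) ^ c) • σ - ρ).PosSemidef), (c : EReal)

/-- The smooth max-relative entropy: the infimum of `D_max(ρ'‖σ)` over the normalized states
`ρ'` at purified distance at most `ε` from `ρ`. -/
def dmaxSmooth {n : Type*} [Fintype n] [DecidableEq n] (ε : ℝ) (ρ σ : Matrix n n ℂ) : EReal :=
  ⨅ (ρ' : Matrix n n ℂ) (_ : IsState ρ' ∧ purifiedDist ρ ρ' ≤ ε), dmax ρ' σ

/-- `min_{σ ∈ F} D_max^ε(ρ‖σ)`. -/
def minDmax {n : Type*} [Fintype n] [DecidableEq n] (ε : ℝ) (ρ : Matrix n n ℂ)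
    (F : Set (Matrix n n ℂ)) : EReal :=
  ⨅ σ ∈ F, dmaxSmooth ε ρ σ

/-! ### Registers and decompositions of the global Hilbert space -/

/-- The kinds of registers that `t` parties may use (a kind is a `t`-partite Hilbert space with
whatever structure the theory attaches to it, for instance a Hamiltonian), with the dimension of
the part held by each party. -/
structure RegisterSystem (t : ℕ) where
  Kind : Type u
  dim : Kind → Fin t → ℕ

/-- Product basis of a register of the given kind. -/
abbrev RegisterSystem.Basis {t : ℕ} (R : RegisterSystem.{u} t) (K : R.Kind) : Type :=
  ∀ p : Fin t, Fin (R.dim K p)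

/-- Positions of the `r = m + 2` registers, in their order: first `sys` (the register `M`), then
`cat 0, …, cat (m-1)` (together the register `E`), last `rand` (the registers `J₁ ⋯ J_t`). -/
inductive Slot (m : ℕ) where
  | sys : Slot m
  | cat : Fin m → Slot m
  | rand : Slot m
  deriving DecidableEq, Fintype

/-- A choice of the global Hilbert space with its ordered decomposition, the first register being
of kind `M`. The last register consists of `t` parts of the same dimension `ell`; its canonical
basis is the standard basis of each part. -/
structure Framework {t : ℕ} (R : RegisterSystem.{u} t) (M : R.Kind) where
  m : ℕ
  kind : Fin m → R.Kind
  ell : ℕ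
  ell_pos : 0 < ell

namespace Framework

variable {t : ℕ} {R : RegisterSystem.{u} t} {M : R.Kind} (fw : Framework R M)

/-- Dimension of the part of a register that is held by party `p`. -/
abbrev localDim : Slot fw.m → Fin t → ℕ
  | .sys => R.dim M
  | .cat i => R.dim (fw.kind i)
  | .rand => fun _ => fw.ell

/-- Product basis of the register at a position. -/
abbrev Space (s : Slot fw.m) : Type := ∀ p : Fin t, Fin (fw.localDim s p)

/-- Product basis of `⨂_{s ∈ L} ℋ_s`. -/
abbrev Idx (L : Finset (Slot fw.m)) : Type := ∀ s : L, fw.Space s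

/-- Operators on `⨂_{s ∈ L} ℋ_s`. -/
abbrev Op (L : Finset (Slot fw.m)) : Type := Matrix (fw.Idx L) (fw.Idx L) ℂ

variable {fw}

/-- Part of a basis label that belongs to the registers in `K ⊆ N`. -/
def restr {K N : Finset (Slot fw.m)} (h : K ⊆ N) (x : fw.Idx N) : fw.Idx K :=
  fun s => x ⟨s.1, h s.2⟩

/-- `A ⊗ B` on the registers of `N`; it is used when `N` is the disjoint union of `K` and `L`. -/
def tensor {K L N : Finset (Slot fw.m)} (hK : K ⊆ N) (hL : L ⊆ N)
    (A : fw.Op K) (B : fw.Op L) : fw.Op N :=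
  Matrix.of fun x y => A (restr hK x) (restr hK y) * B (restr hL x) (restr hL y)

/-- The label on `N` with part `x` on `K` and part `z` on `N \ K`. -/
def glue {K N : Finset (Slot fw.m)} (x : fw.Idx K) (z : fw.Idx (N \ K)) : fw.Idx N :=
  fun s => if h : s.1 ∈ K then x ⟨s.1, h⟩ else z ⟨s.1, Finset.mem_sdiff.2 ⟨s.2, h⟩⟩

/-- Partial trace over the registers in `N \ K`; it is used for `K ⊆ N`. -/
def ptrace {N : Finset (Slot fw.m)} (K : Finset (Slot fw.m)) (A : fw.Op N) : fw.Op K :=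
  Matrix.of fun x y => ∑ z : fw.Idx (N \ K), A (glue x z) (glue y z)

/-- An operator of a single register, as an operator on the one-element collection `{s}`. -/
def lift (s : Slot fw.m) (A : Matrix (fw.Space s) (fw.Space s) ℂ) : fw.Op {s} :=
  A.submatrix (fun x => x ⟨s, Finset.mem_singleton_self s⟩)
    (fun x => x ⟨s, Finset.mem_singleton_self s⟩)

variable (fw)

/-- All registers but the last: `M E`. -/
abbrev ME : Finset (Slot fw.m) := {Slot.rand}ᶜ

/-- All registers but the first: `E J₁ ⋯ J_t`. -/
abbrev EJ : Finset (Slot fw.m) := {Slot.sys}ᶜ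

/-- The registers between the first and the last; empty if `r = 2`. -/
abbrev E : Finset (Slot fw.m) := {Slot.sys, Slot.rand}ᶜ

/-- `|k⟩⟨k| ⊗ ⋯ ⊗ |k⟩⟨k|` on the last register. -/
def ketbra (k : Fin fw.ell) : fw.Op {Slot.rand} :=
  lift Slot.rand (Matrix.single (fun _ => k) (fun _ => k) 1)

/-- `∑ₖ Aₖ ⊗ |k⟩⟨k| ⊗ ⋯ ⊗ |k⟩⟨k|`, with `Aₖ` acting on all registers but the last. -/
def controlled (A : Fin fw.ell → fw.Op fw.ME) : fw.Op Finset.univ :=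
  ∑ k, tensor (Finset.subset_univ _) (Finset.subset_univ _) (A k) (fw.ketbra k)

end Framework

/-- Identification of the bases of two registers with the same local dimensions. -/
def RegisterSystem.castBasis {t : ℕ} (R : RegisterSystem.{u} t) {K K' : R.Kind}
    (h : R.dim K = R.dim K') (x : R.Basis K) : R.Basis K' :=
  fun p => Fin.cast (congrFun h p) (x p)

/-- Interchange of the contents of the first register and of register `cat j`. -/
def Framework.swapIdx {t : ℕ} {R : RegisterSystem.{u} t} {M : R.Kind} {fw : Framework R M}
    (h : ∀ i, R.dim (fw.kind i) = R.dim M) (j : Fin fw.m)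
    (x : fw.Idx Finset.univ) : fw.Idx Finset.univ
  | ⟨.sys, _⟩ => R.castBasis (h j) (x ⟨.cat j, Finset.mem_univ _⟩)
  | ⟨.cat i, hi⟩ =>
      if i = j then R.castBasis (h i).symm (x ⟨.sys, Finset.mem_univ _⟩) else x ⟨.cat i, hi⟩
  | ⟨.rand, hr⟩ => x ⟨.rand, hr⟩

/-! ### Resource theories -/

/-- The free states `F_L` in one framework, for the nonempty collections `L` of registers (the
value at `L = ∅` plays no role). -/
structure FreeFamily {t : ℕ} {R : RegisterSystem.{u} t} {M : R.Kind} (fw : Framework R M) where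
  free : ∀ L : Finset (Slot fw.m), Set (fw.Op L)
  isState : ∀ L, L.Nonempty → ∀ σ ∈ free L, IsState σ
  convex : ∀ L, L.Nonempty → Convex ℝ (free L)
  closed : ∀ L, L.Nonempty → IsClosed (free L)
  tensor_mem : ∀ (K L N : Finset (Slot fw.m)) (hK : K ⊆ N) (hL : L ⊆ N),
    K.Nonempty → L.Nonempty → Disjoint K L → K ∪ L = N →
    ∀ σ ∈ free K, ∀ τ ∈ free L, Framework.tensor hK hL σ τ ∈ free N
  ptrace_mem : ∀ K N : Finset (Slot fw.m), K ⊆ N → K.Nonempty →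
    ∀ σ ∈ free N, Framework.ptrace K σ ∈ free K

/-- The free operations `U_L`: the unitaries `U` such that `U` and `U†` preserve `F_L`. -/
def FreeFamily.freeOps {t : ℕ} {R : RegisterSystem.{u} t} {M : R.Kind} {fw : Framework R M}
    (F : FreeFamily fw) (L : Finset (Slot fw.m)) : Set (fw.Op L) :=
  {U | U ∈ Matrix.unitaryGroup (fw.Idx L) ℂ ∧
    (∀ σ ∈ F.free L, U * σ * U.conjTranspose ∈ F.free L) ∧
    (∀ σ ∈ F.free L, U.conjTranspose * σ * U ∈ F.free L)}

/-- A resource theory: free states in every framework. The free states of one single register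
other than the last one depend only on the kind of the register. -/
structure ResourceTheory {t : ℕ} (R : RegisterSystem.{u} t) where
  single : ∀ K : R.Kind, Set (Matrix (R.Basis K) (R.Basis K) ℂ)
  family : ∀ {M : R.Kind} (fw : Framework R M), FreeFamily fw
  single_sys : ∀ {M : R.Kind} (fw : Framework R M) (A : Matrix (R.Basis M) (R.Basis M) ℂ),
    Framework.lift (fw := fw) Slot.sys A ∈ (family fw).free {Slot.sys} ↔ A ∈ single M
  single_cat : ∀ {M : R.Kind} (fw : Framework R M) (i : Fin fw.m)
    (A : Matrix (R.Basis (fw.kind i)) (R.Basis (fw.kind i)) ℂ),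
    Framework.lift (fw := fw) (Slot.cat i) A ∈ (family fw).free {Slot.cat i} ↔
      A ∈ single (fw.kind i)

namespace ResourceTheory

variable {t : ℕ} {R : RegisterSystem.{u} t} (T : ResourceTheory R) {M : R.Kind}
  (fw : Framework R M)

/-- The assumption on the free states in a framework. First, the free states on all registers are
the convex combinations of `(1/ℓ) ∑ₖ Uₖ σ Uₖ† ⊗ |k⟩⟨k| ⊗ ⋯ ⊗ |k⟩⟨k|`. Second, if all registers
but the last have the same Hilbert space and the same free states, then the free states on all
registers are closed under the interchange of the first register with any other one but the
last. (The restriction on the operations is part of `IsTransformation`.) -/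
structure PerfectlyCorrelated : Prop where
  free_eq : (T.family fw).free Finset.univ = convexHull ℝ
    {τ | ∃ σ ∈ (T.family fw).free fw.ME, ∃ U : Fin fw.ell → fw.Op fw.ME,
      (∀ k, U k ∈ (T.family fw).freeOps fw.ME) ∧
      τ = ((fw.ell : ℝ)⁻¹) • fw.controlled (fun k => U k * σ * (U k).conjTranspose)}
  swap_mem : ∀ h : ∀ i, R.dim (fw.kind i) = R.dim M,
    (∀ i, ∀ A : Matrix (R.Basis M) (R.Basis M) ℂ,
      A.submatrix (R.castBasis (h i)) (R.castBasis (h i)) ∈ T.single (fw.kind i) ↔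
        A ∈ T.single M) →
    ∀ j, ∀ σ ∈ (T.family fw).free Finset.univ,
      σ.submatrix (Framework.swapIdx h j) (Framework.swapIdx h j) ∈
        (T.family fw).free Finset.univ

/-- The final state `Θ = U (ρ ⊗ μ) U†`. -/
def finalState (ρ : Matrix (R.Basis M) (R.Basis M) ℂ) (μ : fw.Op fw.EJ)
    (U : fw.Op Finset.univ) : fw.Op Finset.univ :=
  U * Framework.tensor (Finset.subset_univ _) (Finset.subset_univ _)
    (Framework.lift (fw := fw) Slot.sys ρ) μ * U.conjTranspose

/-- The free state `μ` on `E J₁ ⋯ J_t`, the free operation `U` and the free state `σ` on `M E`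
form an `(ε, log ℓ, t)`-transformation of `ρ`. The operation has to be of the form
`∑ₖ Vₖ ⊗ |k⟩⟨k| ⊗ ⋯ ⊗ |k⟩⟨k|` with free `Vₖ`; for `t ≥ 2` this sum is not unitary on the whole
space but only on the range of `∑ₖ 1 ⊗ |k⟩⟨k| ⊗ ⋯ ⊗ |k⟩⟨k|`, and the unitary `U` has to agree with
it there. -/
structure IsTransformation (ρ : Matrix (R.Basis M) (R.Basis M) ℂ) (ε : ℝ)
    (μ : fw.Op fw.EJ) (U : fw.Op Finset.univ) (σ : fw.Op fw.ME) : Prop where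
  μ_mem : μ ∈ (T.family fw).free fw.EJ
  U_mem : U ∈ (T.family fw).freeOps Finset.univ
  U_controlled : ∃ V : Fin fw.ell → fw.Op fw.ME, (∀ k, V k ∈ (T.family fw).freeOps fw.ME) ∧
    U * fw.controlled (fun _ => 1) = fw.controlled V
  σ_mem : σ ∈ (T.family fw).free fw.ME
  dist_le : purifiedDist (Framework.ptrace fw.ME (finalState fw ρ μ U)) σ ≤ ε

/-- The transformation is catalytic: `μ = μ_E ⊗ μ_J` and `σ = σ_M ⊗ μ_E` with `σ_M` free. -/
def IsCatalytic (μ : fw.Op fw.EJ) (σ : fw.Op fw.ME) : Prop :=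
  ∃ (μE : fw.Op fw.E) (μJ : fw.Op {Slot.rand}) (σM : Matrix (R.Basis M) (R.Basis M) ℂ),
    IsState μE ∧ IsState μJ ∧ σM ∈ T.single M ∧
    μ = Framework.tensor (by simp [Framework.E, Framework.EJ]) (by simp [Framework.EJ]) μE μJ ∧
    σ = Framework.tensor (by simp [Framework.ME])
      (by simp [Framework.E, Framework.ME]) (Framework.lift (fw := fw) Slot.sys σM) μE

end ResourceTheory

end CatalyticResource

end

open CatalyticResource

/-! The fidelity is handled through one variational formula: it is the maximum of `Re Tr (A B†)`
over rectangular `A`, `B` with `A A† ≤ ρ` and `B B† ≤ σ` (`re_trace_le_fidelity`,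
`exists_re_trace_eq_fidelity`). Its monotonicity properties follow by transforming an optimal pair
of factors.

Achievability is convex splitting. Let `σ` and `ρ'` be optimal, so that `ρ' ≤ 2^k σ`. The catalyst
consists of `n` copies of `σ`, the last register is uniform shared randomness with `n + 1` values,
and, controlled by its value, `M` is interchanged with one of the `n + 1` copies (itself included).
The marginal on `M E` is then the uniform mixture of `ρ` hidden at one position among copies of `σ`.
For `ρ'` in place of `ρ`, the second moment relative to `σ^{⊗(n+1)}` is at most `1 + (2^k - 1)/(n +
1)`, because distinct positions are uncorrelated; this bounds the fidelity
(`inv_sqrt_le_fidelity_splitState`), and the triangle inequality for the purified distance adds `ε`.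

The converse runs the protocol backwards (`minDmax_le_logb_ell`). Free states are classical on `J`,
so `Θ` is block diagonal. As in Uhlmann's theorem, `σ_ME` has a block diagonal extension with blocks
`σ'_k` that is as close to `Θ` as `σ_ME` is to `Θ_ME`. Since `σ'_k ≤ σ_ME`, this extension is at
most `ℓ` times a free state. Undoing `U` and tracing out all but `M` gives a state near `ρ`
dominated by `ℓ` times a free state of `M`.

The minimum is attained by compactness (`exists_optimal`). -/

noncomputable section

namespace CatalyticResource

open Matrix

/-! ### Loewner order, Douglas factorization and contractions -/

section Loewner

variable {n m l : Type*} [Fintype n] [Fintype m] [Fintype l]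

theorem conjTranspose_eq_of_nonneg {n : Type*} {A : Matrix n n ℂ} (hA : 0 ≤ A) : Aᴴ = A :=
  (nonneg_iff_posSemidef.1 hA).isHermitian

theorem conj_nonneg {A : Matrix n n ℂ} (hA : 0 ≤ A) (B : Matrix m n ℂ) : 0 ≤ B * A * Bᴴ :=
  nonneg_iff_posSemidef.2 ((nonneg_iff_posSemidef.1 hA).mul_mul_conjTranspose_same B)

theorem conj_mono {A A' : Matrix n n ℂ} (h : A ≤ A') (B : Matrix m n ℂ) :
    B * A * Bᴴ ≤ B * A' * Bᴴ := by
  rw [← sub_nonneg, ← Matrix.sub_mul, ← Matrix.mul_sub]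
  exact conj_nonneg (sub_nonneg.2 h) B

theorem self_mul_conjTranspose_nonneg (A : Matrix n m ℂ) : 0 ≤ A * Aᴴ :=
  nonneg_iff_posSemidef.2 (posSemidef_self_mul_conjTranspose A)

theorem trace_re_nonneg {A : Matrix n n ℂ} (hA : 0 ≤ A) : 0 ≤ A.trace.re :=
  (Complex.le_def.1 (nonneg_iff_posSemidef.1 hA).trace_nonneg).1

theorem trace_re_mono {A B : Matrix n n ℂ} (h : A ≤ B) : A.trace.re ≤ B.trace.re := by
  have := trace_re_nonneg (sub_nonneg.2 h)
  rw [trace_sub, Complex.sub_re] at this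
  linarith

theorem eq_zero_of_self_mul_conjTranspose_nonpos {A : Matrix n m ℂ} (h : A * Aᴴ ≤ 0) : A = 0 :=
  self_mul_conjTranspose_eq_zero.1 (le_antisymm h (self_mul_conjTranspose_nonneg A))

theorem re_trace_mul_conjTranspose_comm (A B : Matrix n m ℂ) :
    (A * Bᴴ).trace.re = (B * Aᴴ).trace.re := by
  have : (B * Aᴴ) = (A * Bᴴ)ᴴ := by rw [conjTranspose_mul, conjTranspose_conjTranspose]
  rw [this, trace_conjTranspose]
  exact (Complex.conj_re _).symm

theorem re_trace_cauchy_schwarz (A B : Matrix n m ℂ) {a b : ℝ} (hb : 0 ≤ b)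
    (ha : 0 ≤ a) (hA : (A * Aᴴ).trace.re ≤ a ^ 2) (hB : (B * Bᴴ).trace.re ≤ b ^ 2) :
    (A * Bᴴ).trace.re ≤ a * b := by
  have key : ∀ s : ℝ, 0 ≤ (A * Aᴴ).trace.re - 2 * s * (A * Bᴴ).trace.re
      + s ^ 2 * (B * Bᴴ).trace.re := by
    intro s
    have h := trace_re_nonneg (self_mul_conjTranspose_nonneg (A - (s : ℂ) • B))
    rw [conjTranspose_sub, conjTranspose_smul, Matrix.mul_sub, Matrix.sub_mul, Matrix.sub_mul,
      Matrix.smul_mul, Matrix.mul_smul, Matrix.mul_smul, Matrix.smul_mul] at h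
    simp only [trace_sub, trace_smul, Complex.sub_re, smul_eq_mul, Complex.star_def,
      Complex.conj_ofReal, Complex.re_ofReal_mul] at h
    rw [re_trace_mul_conjTranspose_comm B A] at h
    linarith
  have hA0 := trace_re_nonneg (self_mul_conjTranspose_nonneg A)
  have hB0 := trace_re_nonneg (self_mul_conjTranspose_nonneg B)
  have hd : discrim (B * Bᴴ).trace.re (-2 * (A * Bᴴ).trace.re) (A * Aᴴ).trace.re ≤ 0 :=
    discrim_le_zero fun s => by have := key s; linarith
  rw [discrim] at hd
  refine (abs_le_of_sq_le_sq' ?_ (mul_nonneg ha hb)).2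
  have : (A * Aᴴ).trace.re * (B * Bᴴ).trace.re ≤ a ^ 2 * b ^ 2 :=
    mul_le_mul hA hB hB0 (sq_nonneg a)
  linarith

variable [DecidableEq n]

theorem conjTranspose_sqrt (A : Matrix n n ℂ) : (CFC.sqrt A)ᴴ = CFC.sqrt A :=
  conjTranspose_eq_of_nonneg (CFC.sqrt_nonneg A)

theorem sqrt_mul_conjTranspose_sqrt {A : Matrix n n ℂ} (hA : 0 ≤ A) :
    CFC.sqrt A * (CFC.sqrt A)ᴴ = A := by
  rw [conjTranspose_sqrt, CFC.sqrt_mul_sqrt_self A hA]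

/-- If `S K S† = 0` with `K ≥ 0` then `S K = 0`. -/
theorem mul_eq_zero_of_conj_eq_zero {m : Type*} {K : Matrix n n ℂ} (hK : 0 ≤ K) {S : Matrix m n ℂ}
    (h : S * K * Sᴴ = 0) : S * K = 0 := by
  have h1 : S * CFC.sqrt K = 0 := by
    apply self_mul_conjTranspose_eq_zero.1
    rw [conjTranspose_mul, conjTranspose_sqrt, Matrix.mul_assoc, ← Matrix.mul_assoc (CFC.sqrt K),
      CFC.sqrt_mul_sqrt_self K hK, ← Matrix.mul_assoc, h]
  rw [← CFC.sqrt_mul_sqrt_self K hK, ← Matrix.mul_assoc, h1, Matrix.zero_mul]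

/-- A Hermitian generalized inverse that commutes with the given matrix. -/
theorem exists_commuting_pseudoinverse {S : Matrix n n ℂ} (hS : S.IsHermitian) :
    ∃ G : Matrix n n ℂ, Gᴴ = G ∧ G * S = S * G ∧ S * G * S = S := by
  set U := (hS.eigenvectorUnitary : Matrix n n ℂ) with hU
  have hUU : star U * U = 1 := Unitary.coe_star_mul_self hS.eigenvectorUnitary
  set d := hS.eigenvalues
  set D : Matrix n n ℂ := diagonal (fun i => (d i : ℂ)) with hD
  -- With the convention `0⁻¹ = 0` the kernel of `S` stays in the kernel of its generalized inverse.
  set D' : Matrix n n ℂ := diagonal (fun i => ((d i)⁻¹ : ℂ)) with hD'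
  have hSe : S = U * D * star U := by
    conv_lhs => rw [hS.spectral_theorem]
    rw [Unitary.conjStarAlgAut_apply]; rfl
  have key : ∀ X Y : Matrix n n ℂ, U * X * star U * (U * Y * star U) = U * (X * Y) * star U := by
    intro X Y
    calc U * X * star U * (U * Y * star U) = U * X * (star U * U) * Y * star U := by
          simp only [Matrix.mul_assoc]
      _ = _ := by rw [hUU]; simp only [Matrix.mul_assoc, Matrix.one_mul]
  refine ⟨U * D' * star U, ?_, ?_, ?_⟩
  · rw [← star_eq_conjTranspose, star_mul, star_mul, star_star, Matrix.mul_assoc]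
    congr 2
    rw [hD', star_eq_conjTranspose, diagonal_conjTranspose]
    congr 1; ext i; simp
  · rw [hSe, key, key, hD, hD', diagonal_mul_diagonal, diagonal_mul_diagonal]
    simp only [mul_comm]
  · rw [hSe, key, key, hD, hD', diagonal_mul_diagonal, diagonal_mul_diagonal]
    congr 3; ext i
    by_cases h : d i = 0 <;> simp [h]

/-- Douglas factorization. -/
theorem exists_factor_of_le {S : Matrix n n ℂ} (hS : S.IsHermitian) {A : Matrix n m ℂ}
    (h : A * Aᴴ ≤ S * S) : ∃ W : Matrix n m ℂ, A = S * W ∧ W * Wᴴ ≤ 1 := by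
  obtain ⟨G, hG, hc, hSGS⟩ := exists_commuting_pseudoinverse hS
  -- `P` is the orthogonal projection onto the range of `S`. Compressing the hypothesis by `1 - P`
  -- shows that `A` has its range there, so `W = G A` works, with `W W† ≤ G S S G = P ≤ 1`.
  obtain ⟨P, hP⟩ : ∃ P, P = S * G := ⟨_, rfl⟩
  rw [← hP] at hSGS
  have hPh : Pᴴ = P := by rw [hP, conjTranspose_mul, hG, hS.eq, hc]
  have hPP : P * P = P := by nth_rw 2 [hP]; rw [← Matrix.mul_assoc, hSGS, hP]
  have hPS : P * S = S := hSGS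
  have hA : A = P * A := by
    rw [← sub_eq_zero]
    have : A - P * A = (1 - P) * A := by rw [Matrix.sub_mul, Matrix.one_mul]
    rw [this]
    apply eq_zero_of_self_mul_conjTranspose_nonpos
    have h1 := conj_mono h (1 - P)
    have h2 : (1 - P) * (S * S) = 0 := by
      rw [← Matrix.mul_assoc, Matrix.sub_mul, hPS, Matrix.one_mul, sub_self, Matrix.zero_mul]
    rw [h2, Matrix.zero_mul] at h1
    rwa [conjTranspose_mul, Matrix.mul_assoc, ← Matrix.mul_assoc A, ← Matrix.mul_assoc]
  refine ⟨G * A, by rw [← Matrix.mul_assoc, ← hP]; exact hA, ?_⟩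
  have h1 := conj_mono h G
  have h2 : G * (S * S) * Gᴴ = P := by
    rw [hG, ← Matrix.mul_assoc, hc, Matrix.mul_assoc, ← hP, hPP]
  have h3 : P ≤ 1 := by
    have := self_mul_conjTranspose_nonneg (1 - P)
    rw [conjTranspose_sub, conjTranspose_one, hPh, Matrix.mul_sub, Matrix.mul_one,
      Matrix.sub_mul, Matrix.one_mul, hPP, sub_self, sub_zero] at this
    exact sub_nonneg.1 this
  rw [conjTranspose_mul, Matrix.mul_assoc, ← Matrix.mul_assoc A, ← Matrix.mul_assoc]
  exact (h1.trans_eq h2).trans h3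

/-- In `A = S W` with `A A† = S S`, the contraction `W` is a co-isometry on the range of `S`. -/
theorem mul_mul_conjTranspose_eq_self {S : Matrix n n ℂ} (hS : S.IsHermitian) {W : Matrix n m ℂ}
    (hW : W * Wᴴ ≤ 1) (h : S * W * (S * W)ᴴ = S * S) : S * (W * Wᴴ) = S := by
  have h1 : S * (1 - W * Wᴴ) = 0 := by
    apply mul_eq_zero_of_conj_eq_zero (sub_nonneg.2 hW)
    rw [Matrix.mul_sub, Matrix.sub_mul, Matrix.mul_one, hS.eq, sub_eq_zero, ← h, conjTranspose_mul,
      hS.eq]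
    simp only [Matrix.mul_assoc]
  rw [Matrix.mul_sub, Matrix.mul_one, sub_eq_zero] at h1
  exact h1.symm

/-- For `X = W† W` the hypothesis gives `X² ≤ X`, and `1 - X = (1 - X)² + (X - X²)`. -/
theorem conjTranspose_mul_self_le_one [DecidableEq m] {W : Matrix n m ℂ} (hW : W * Wᴴ ≤ 1) :
    Wᴴ * W ≤ 1 := by
  have h1 : Wᴴ * W * (Wᴴ * W) ≤ Wᴴ * W := by
    have := conj_mono hW Wᴴ
    rw [conjTranspose_conjTranspose, Matrix.mul_one] at this
    simpa only [Matrix.mul_assoc] using this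
  have h2 := self_mul_conjTranspose_nonneg (1 - Wᴴ * W)
  rw [conjTranspose_sub, conjTranspose_one, conjTranspose_mul, conjTranspose_conjTranspose,
    Matrix.mul_sub, Matrix.mul_one] at h2
  have h3 := add_nonneg h2 (sub_nonneg.2 h1)
  rw [← sub_nonneg]
  convert h3 using 1
  simp only [Matrix.sub_mul, Matrix.one_mul]
  abel

theorem mul_contraction {W : Matrix l n ℂ} [DecidableEq l] (hW : W * Wᴴ ≤ 1) {V : Matrix n m ℂ}
    (hV : V * Vᴴ ≤ 1) : W * V * (W * V)ᴴ ≤ 1 := by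
  have := conj_mono hV W
  rw [Matrix.mul_one] at this
  rw [conjTranspose_mul]
  calc W * V * (Vᴴ * Wᴴ) = W * (V * Vᴴ) * Wᴴ := by simp only [Matrix.mul_assoc]
    _ ≤ _ := this.trans hW

/-- The operator `(1 - K)(1 - K)† + (1 - K K†) = 2 - K - K†` is positive; it is paired with `H`. -/
theorem re_trace_mul_le {K H : Matrix n n ℂ} (hK : K * Kᴴ ≤ 1) (hH : 0 ≤ H) :
    (K * H).trace.re ≤ H.trace.re := by
  have h0 : 0 ≤ (1 - K) * (1 - K)ᴴ + (1 - K * Kᴴ) :=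
    add_nonneg (self_mul_conjTranspose_nonneg _) (sub_nonneg.2 hK)
  have h1 : 0 ≤ ((CFC.sqrt H) * ((1 - K) * (1 - K)ᴴ + (1 - K * Kᴴ)) * (CFC.sqrt H)ᴴ).trace.re :=
    trace_re_nonneg (conj_nonneg h0 _)
  have h2 : (1 - K) * (1 - K)ᴴ + (1 - K * Kᴴ) = 1 + 1 - K - Kᴴ := by
    rw [conjTranspose_sub, conjTranspose_one, Matrix.mul_sub, Matrix.mul_one, Matrix.sub_mul,
      Matrix.one_mul]
    abel
  rw [h2, trace_mul_comm, ← Matrix.mul_assoc, conjTranspose_sqrt, CFC.sqrt_mul_sqrt_self H hH,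
    Matrix.mul_sub, Matrix.mul_sub, Matrix.mul_add, Matrix.mul_one, trace_sub, trace_sub, trace_add,
    trace_mul_comm H K] at h1
  have h3 := re_trace_mul_conjTranspose_comm H K
  rw [conjTranspose_eq_of_nonneg hH] at h3
  simp only [Complex.add_re, Complex.sub_re] at h1
  linarith

end Loewner

/-! ### Variational formula for the fidelity and the triangle inequality -/

section Fidelity

variable {n m : Type*} [Fintype n] [DecidableEq n] [Fintype m]

/-- Polar decomposition: Douglas factorization applies to `Y†`, since `Y† Y = |Y|²`, and yields `Y†
= |Y| W`. As `W W†` acts trivially on the range of `|Y|`, the contraction `W` attains the trace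
norm. -/
theorem traceNorm_attained (Y : Matrix n n ℂ) :
    ∃ W : Matrix n n ℂ, W * Wᴴ ≤ 1 ∧ Y = Wᴴ * CFC.sqrt (Yᴴ * Y) ∧
      (W * Y).trace.re = traceNorm Y := by
  have hnn : 0 ≤ Yᴴ * Y := by simpa using self_mul_conjTranspose_nonneg Yᴴ
  set H := CFC.sqrt (Yᴴ * Y) with hH
  have hHh : H.IsHermitian := conjTranspose_sqrt _
  have hHH : H * H = Yᴴ * Y := CFC.sqrt_mul_sqrt_self _ hnn
  obtain ⟨W, hYW, hW⟩ := exists_factor_of_le (A := Yᴴ) hHh (by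
    rw [conjTranspose_conjTranspose, hHH])
  have hY : Y = Wᴴ * H := by
    rw [← conjTranspose_conjTranspose Y, hYW, conjTranspose_mul, hHh.eq]
  have h1 := mul_mul_conjTranspose_eq_self hHh hW (by
    rw [← hYW, conjTranspose_conjTranspose, hHH])
  refine ⟨W, hW, hY, ?_⟩
  rw [traceNorm, ← hH]
  conv_lhs => rw [hY]
  rw [← Matrix.mul_assoc, trace_mul_comm, h1]

theorem re_trace_mul_le_traceNorm {C : Matrix n n ℂ} (hC : C * Cᴴ ≤ 1) (Y : Matrix n n ℂ) :
    (C * Y).trace.re ≤ traceNorm Y := by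
  obtain ⟨W, hW, hY, -⟩ := traceNorm_attained Y
  have hW' : Wᴴ * Wᴴᴴ ≤ 1 := by
    rw [conjTranspose_conjTranspose]; exact conjTranspose_mul_self_le_one hW
  rw [traceNorm]
  conv_lhs => rw [hY]
  rw [← Matrix.mul_assoc]
  exact re_trace_mul_le (mul_contraction hC hW') (CFC.sqrt_nonneg _)

theorem fidelity_nonneg (ρ σ : Matrix n n ℂ) : 0 ≤ fidelity ρ σ :=
  trace_re_nonneg (CFC.sqrt_nonneg _)

/-- Lower bounds on the fidelity from (sub-normalized) purifications. -/
theorem re_trace_le_fidelity {ρ σ : Matrix n n ℂ} {A B : Matrix n m ℂ}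
    (hA : A * Aᴴ ≤ ρ) (hB : B * Bᴴ ≤ σ) : (A * Bᴴ).trace.re ≤ fidelity ρ σ := by
  classical
  have hρ : 0 ≤ ρ := (self_mul_conjTranspose_nonneg A).trans hA
  have hσ : 0 ≤ σ := (self_mul_conjTranspose_nonneg B).trans hB
  -- Writing `A = √ρ V` and `B = √σ W` turns `Tr (B A†)` into the trace of the contraction `W V†`
  -- against `√ρ √σ`.
  obtain ⟨V, rfl, hV⟩ := exists_factor_of_le (S := CFC.sqrt ρ) (conjTranspose_sqrt ρ)
    (A := A) (by rwa [CFC.sqrt_mul_sqrt_self ρ hρ])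
  obtain ⟨W, rfl, hW⟩ := exists_factor_of_le (S := CFC.sqrt σ) (conjTranspose_sqrt σ)
    (A := B) (by rwa [CFC.sqrt_mul_sqrt_self σ hσ])
  have hV' : Vᴴ * Vᴴᴴ ≤ 1 := by
    rw [conjTranspose_conjTranspose]; exact conjTranspose_mul_self_le_one hV
  have h := re_trace_mul_le_traceNorm (mul_contraction hW hV') (CFC.sqrt ρ * CFC.sqrt σ)
  rw [re_trace_mul_conjTranspose_comm, fidelity]
  convert h using 2
  rw [conjTranspose_mul, conjTranspose_sqrt, Matrix.mul_assoc, trace_mul_comm]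
  simp only [Matrix.mul_assoc]

/-- The contraction from the polar decomposition of `√ρ √σ` gives the optimal partner of `√ρ`. This
is the converse half of the variational formula. -/
theorem exists_re_trace_eq_fidelity (ρ : Matrix n n ℂ) {σ : Matrix n n ℂ} (hσ : 0 ≤ σ) :
    ∃ B : Matrix n n ℂ, B * Bᴴ ≤ σ ∧ (CFC.sqrt ρ * Bᴴ).trace.re = fidelity ρ σ := by
  obtain ⟨W, hW, -, h⟩ := traceNorm_attained (CFC.sqrt ρ * CFC.sqrt σ)
  refine ⟨CFC.sqrt σ * W, ?_, ?_⟩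
  · have := conj_mono hW (CFC.sqrt σ)
    rw [Matrix.mul_one, sqrt_mul_conjTranspose_sqrt hσ] at this
    rw [conjTranspose_mul]
    simpa only [Matrix.mul_assoc] using this
  · rw [re_trace_mul_conjTranspose_comm, conjTranspose_sqrt, fidelity, ← h, Matrix.mul_assoc,
      trace_mul_comm]
    simp only [Matrix.mul_assoc]

/-- Triangle inequality for the angle `arccos F`: take optimal factors `A`, `C` of `ρ`, `τ` against
`B = √σ`, split off their components along `B`, and apply Cauchy–Schwarz to the remainders, whose
squared norms are at most `1 - x²` and `1 - y²`. -/
theorem fidelity_angle_triangle {ρ σ τ : Matrix n n ℂ} (hρ : IsState ρ) (hσ : IsState σ)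
    (hτ : IsState τ) :
    fidelity σ ρ * fidelity σ τ -
      Real.sqrt (1 - fidelity σ ρ ^ 2) * Real.sqrt (1 - fidelity σ τ ^ 2) ≤ fidelity ρ τ := by
  have hσ0 := nonneg_iff_posSemidef.2 hσ.1
  obtain ⟨A, hA, hAF⟩ := exists_re_trace_eq_fidelity σ (nonneg_iff_posSemidef.2 hρ.1)
  obtain ⟨C, hC, hCF⟩ := exists_re_trace_eq_fidelity σ (nonneg_iff_posSemidef.2 hτ.1)
  set B := CFC.sqrt σ
  set x := fidelity σ ρ
  set y := fidelity σ τ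
  have hB : (B * Bᴴ).trace.re = 1 := by rw [sqrt_mul_conjTranspose_sqrt hσ0, hσ.2]; rfl
  have hA1 : (A * Aᴴ).trace.re ≤ 1 := (trace_re_mono hA).trans_eq (by rw [hρ.2]; rfl)
  have hC1 : (C * Cᴴ).trace.re ≤ 1 := (trace_re_mono hC).trans_eq (by rw [hτ.2]; rfl)
  have expand : ∀ X Y : Matrix n n ℂ, ∀ p q : ℝ,
      ((X - (p : ℂ) • B) * (Y - (q : ℂ) • B)ᴴ).trace.re = (X * Yᴴ).trace.re
        - p * (B * Yᴴ).trace.re - q * (B * Xᴴ).trace.re + p * q := by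
    intro X Y p q
    rw [conjTranspose_sub, conjTranspose_smul, Matrix.mul_sub, Matrix.sub_mul, Matrix.sub_mul,
      Matrix.smul_mul, Matrix.mul_smul, Matrix.mul_smul, Matrix.smul_mul]
    simp only [trace_sub, trace_smul, Complex.sub_re, smul_eq_mul, Complex.star_def,
      Complex.conj_ofReal, Complex.re_ofReal_mul, hB]
    rw [re_trace_mul_conjTranspose_comm X B]
    ring
  have eA := expand A A x x
  have eC := expand C C y y
  -- Cauchy–Schwarz bounds from above; the sign turns it into a lower bound on `Re Tr (A C†)`.
  have eAC := expand A (-C) x (-y)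
  have hA' : 0 ≤ 1 - x ^ 2 := by
    have := trace_re_nonneg (self_mul_conjTranspose_nonneg (A - (x : ℂ) • B))
    rw [eA, hAF] at this; nlinarith
  have hC' : 0 ≤ 1 - y ^ 2 := by
    have := trace_re_nonneg (self_mul_conjTranspose_nonneg (C - (y : ℂ) • B))
    rw [eC, hCF] at this; nlinarith
  have hneg : -C - ((-y : ℝ) : ℂ) • B = -(C - (y : ℂ) • B) := by
    push_cast; rw [neg_smul]; abel
  have hcs := re_trace_cauchy_schwarz (A - (x : ℂ) • B) (-C - ((-y : ℝ) : ℂ) • B)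
    (Real.sqrt_nonneg (1 - y ^ 2)) (Real.sqrt_nonneg (1 - x ^ 2))
    (by rw [eA, hAF, Real.sq_sqrt hA']; nlinarith)
    (by rw [hneg, conjTranspose_neg, Matrix.neg_mul, Matrix.mul_neg, neg_neg, eC, hCF,
          Real.sq_sqrt hC']; nlinarith)
  rw [eAC, conjTranspose_neg, Matrix.mul_neg, Matrix.mul_neg, trace_neg, trace_neg, Complex.neg_re,
    Complex.neg_re, hAF, hCF] at hcs
  have := re_trace_le_fidelity hA hC
  linarith

theorem fidelity_comm {ρ σ : Matrix n n ℂ} (hρ : 0 ≤ ρ) (hσ : 0 ≤ σ) :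
    fidelity ρ σ = fidelity σ ρ := by
  have key : ∀ ρ σ : Matrix n n ℂ, 0 ≤ ρ → 0 ≤ σ → fidelity ρ σ ≤ fidelity σ ρ := by
    intro ρ σ hρ hσ
    obtain ⟨B, hB, h⟩ := exists_re_trace_eq_fidelity ρ hσ
    rw [← h, re_trace_mul_conjTranspose_comm]
    exact re_trace_le_fidelity hB (sqrt_mul_conjTranspose_sqrt hρ).le
  exact le_antisymm (key _ _ hρ hσ) (key _ _ hσ hρ)

theorem fidelity_le_one {ρ σ : Matrix n n ℂ} (hρ : IsState ρ) (hσ : IsState σ) :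
    fidelity ρ σ ≤ 1 := by
  obtain ⟨B, hB, h⟩ := exists_re_trace_eq_fidelity ρ (nonneg_iff_posSemidef.2 hσ.1)
  rw [← h, ← one_mul (1 : ℝ)]
  refine re_trace_cauchy_schwarz _ _ zero_le_one zero_le_one ?_ ?_
  · rw [sqrt_mul_conjTranspose_sqrt (nonneg_iff_posSemidef.2 hρ.1), hρ.2]; simp
  · refine (trace_re_mono hB).trans ?_
    rw [hσ.2]; simp

theorem purifiedDist_anti {m : Type*} [Fintype m] [DecidableEq m] {ρ σ : Matrix n n ℂ}
    {ρ' σ' : Matrix m m ℂ} (h : fidelity ρ σ ≤ fidelity ρ' σ') :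
    purifiedDist ρ' σ' ≤ purifiedDist ρ σ := by
  rw [purifiedDist, purifiedDist]
  have := pow_le_pow_left₀ (fidelity_nonneg ρ σ) h 2
  exact Real.sqrt_le_sqrt (by linarith)

/-- Triangle inequality for the purified distance. -/
theorem purifiedDist_triangle {ρ σ τ : Matrix n n ℂ} (hρ : IsState ρ) (hσ : IsState σ)
    (hτ : IsState τ) : purifiedDist ρ τ ≤ purifiedDist ρ σ + purifiedDist σ τ := by
  have h := fidelity_angle_triangle hρ hσ hτ
  rw [purifiedDist, purifiedDist, purifiedDist,
    fidelity_comm (nonneg_iff_posSemidef.2 hρ.1) (nonneg_iff_posSemidef.2 hσ.1)]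
  have hx0 := fidelity_nonneg σ ρ
  have hx1 := fidelity_le_one hσ hρ
  have hy0 := fidelity_nonneg σ τ
  have hy1 := fidelity_le_one hσ hτ
  have hz0 := fidelity_nonneg ρ τ
  generalize fidelity σ ρ = x at *
  generalize fidelity σ τ = y at *
  generalize fidelity ρ τ = z at *
  have ha := Real.sq_sqrt (show 0 ≤ 1 - x ^ 2 by nlinarith)
  have hb := Real.sq_sqrt (show 0 ≤ 1 - y ^ 2 by nlinarith)
  have ha0 := Real.sqrt_nonneg (1 - x ^ 2)
  have hb0 := Real.sqrt_nonneg (1 - y ^ 2)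
  generalize Real.sqrt (1 - x ^ 2) = a at *
  generalize Real.sqrt (1 - y ^ 2) = b at *
  refine Real.sqrt_le_iff.2 ⟨add_nonneg ha0 hb0, ?_⟩
  -- If `x y ≤ a b` the angles add up to at least `π/2`, so the angle bound cannot be squared, but
  -- then `a² + b² ≥ 1` suffices. Otherwise the claim is `sin (α + β) ≤ sin α + sin β`.
  rcases le_total (x * y) (a * b) with hc | hc
  · have h1 : x ^ 2 * y ^ 2 ≤ a ^ 2 * b ^ 2 := by
      have := pow_le_pow_left₀ (mul_nonneg hx0 hy0) hc 2
      simpa only [mul_pow] using this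
    have : 1 ≤ a ^ 2 + b ^ 2 := by rw [ha, hb] at h1 ⊢; nlinarith
    nlinarith [mul_nonneg ha0 hb0, sq_nonneg z]
  · have h1 : (x * y - a * b) ^ 2 ≤ z ^ 2 := pow_le_pow_left₀ (by linarith) h 2
    have h2 : 1 - (x * y - a * b) ^ 2 = (x * b + y * a) ^ 2 := by
      have hx2 : x ^ 2 = 1 - a ^ 2 := by linarith
      have hy2 : y ^ 2 = 1 - b ^ 2 := by linarith
      ring_nf
      rw [hx2, hy2]; ring
    have h3 : (x * b + y * a) ^ 2 ≤ (a + b) ^ 2 :=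
      pow_le_pow_left₀ (by positivity) (by nlinarith) 2
    linarith

/-- If `τ = S T S†` and `ω = S S†`, the fidelity of `τ` and `ω` is controlled by the second moment
`Tr S T² S†`. -/
theorem inv_sqrt_le_fidelity {τ ω S T : Matrix n n ℂ} (hT : 0 ≤ T) (hω : S * Sᴴ = ω)
    (hτ : S * T * Sᴴ = τ) (hτ1 : τ.trace.re = 1) {Q : ℝ} (hQ : 0 < Q)
    (h : (S * (T * T) * Sᴴ).trace.re ≤ Q) : (Real.sqrt Q)⁻¹ ≤ fidelity τ ω := by
  set R := CFC.sqrt T with hR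
  have hR0 : 0 ≤ R := CFC.sqrt_nonneg T
  have hRR : R * R = T := CFC.sqrt_mul_sqrt_self T hT
  have hRh : Rᴴ = R := conjTranspose_sqrt T
  have h1 := re_trace_le_fidelity (ρ := τ) (σ := ω) (A := S * R) (B := S)
    (by rw [conjTranspose_mul, hRh, ← hτ, ← hRR]; simp only [Matrix.mul_assoc]; exact le_rfl) hω.le
  refine le_trans ?_ h1
  set s := Real.sqrt Q with hs
  have hs0 : 0 < s := Real.sqrt_pos.2 hQ
  have hsQ : s ^ 2 = Q := Real.sq_sqrt hQ.le
  have hn : 0 ≤ R * R + (2 * s) • R :=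
    add_nonneg (by rw [hRR]; exact hT) (smul_nonneg (by positivity) hR0)
  have hpos := trace_re_nonneg (conj_nonneg (conj_nonneg hn (R - s • (1 : Matrix n n ℂ))) S)
  -- Operator form of `(r - s)² (r² + 2 s r) = r⁴ - 3 s² r² + 2 s³ r ≥ 0` for `r = √T`. With `Tr S T
  -- S† = 1`, `Tr S T² S† ≤ s²` and `f = Tr S √T S†` it gives `2 s³ f ≥ 2 s²`. This replaces the
  -- Hölder estimate `E T ≤ (E T²)^{1/3} (E √T)^{2/3}`; `s = √Q` is the value that makes it sharp.
  have hpoly : (R - s • (1 : Matrix n n ℂ)) * (R * R + (2 * s) • R) *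
      (R - s • (1 : Matrix n n ℂ))ᴴ = T * T - (3 * s ^ 2) • T + (2 * s ^ 3) • R := by
    rw [conjTranspose_sub, conjTranspose_smul, conjTranspose_one, hRh, ← hRR]
    simp only [Matrix.mul_sub, Matrix.sub_mul, Matrix.mul_add, Matrix.add_mul, Matrix.smul_mul,
      Matrix.mul_smul, Matrix.mul_one, Matrix.one_mul, star_trivial, Matrix.mul_assoc, smul_sub,
      smul_add, smul_smul]
    module
  rw [hpoly, Matrix.mul_add, Matrix.mul_sub, Matrix.add_mul, Matrix.sub_mul, Matrix.mul_smul,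
    Matrix.smul_mul, Matrix.mul_smul, Matrix.smul_mul, hτ, trace_add, trace_sub, trace_smul,
    trace_smul, Complex.add_re, Complex.sub_re, Complex.smul_re, Complex.smul_re, hτ1] at hpos
  simp only [smul_eq_mul] at hpos
  generalize (S * R * Sᴴ).trace.re = f at *
  rw [inv_le_iff_one_le_mul₀ hs0]
  have : 2 * s ^ 2 * 1 ≤ 2 * s ^ 2 * (f * s) := by nlinarith
  exact le_of_mul_le_mul_left this (by positivity)

end Fidelity

/-! ### Factors with several blocks of columns -/

section Columns

variable {ι n m : Type*} [Fintype ι] [Fintype n] [DecidableEq n] [Fintype m]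

/-- Matrices placed next to each other. -/
def cols (A : ι → Matrix n m ℂ) : Matrix n (ι × m) ℂ := of fun x p => A p.1 x p.2

theorem cols_mul_conjTranspose {n : Type*} (A B : ι → Matrix n m ℂ) :
    cols A * (cols B)ᴴ = ∑ i, A i * (B i)ᴴ := by
  ext x y
  simp [cols, mul_apply, Fintype.sum_prod_type, Matrix.sum_apply]

theorem sum_re_trace_le_fidelity {ρ σ : Matrix n n ℂ} {A B : ι → Matrix n m ℂ}
    (hA : ∑ i, A i * (A i)ᴴ ≤ ρ) (hB : ∑ i, B i * (B i)ᴴ ≤ σ) :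
    ∑ i, (A i * (B i)ᴴ).trace.re ≤ fidelity ρ σ := by
  rw [← cols_mul_conjTranspose] at hA hB
  have := re_trace_le_fidelity hA hB
  rwa [cols_mul_conjTranspose, trace_sum, Complex.re_sum] at this

/-- Douglas factorization of the blocks placed side by side. In the converse it distributes an
optimal factor over the values of the shared randomness. -/
theorem exists_factors_of_sum_eq {S : Matrix n n ℂ} (hS : S.IsHermitian) {A : ι → Matrix n m ℂ}
    (h : ∑ i, A i * (A i)ᴴ = S * S) :
    ∃ W : ι → Matrix n m ℂ, (∀ i, A i = S * W i) ∧ ∑ i, W i * (W i)ᴴ ≤ 1 ∧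
      S * ∑ i, W i * (W i)ᴴ = S := by
  rw [← cols_mul_conjTranspose] at h
  obtain ⟨V, hV, hV1⟩ := exists_factor_of_le hS h.le
  have hVW : V = cols fun i => of fun x y => V x (i, y) := rfl
  have h1 := mul_mul_conjTranspose_eq_self hS hV1 (by rw [← hV, h])
  rw [hVW, cols_mul_conjTranspose] at hV1 h1
  refine ⟨_, fun i => ?_, hV1, h1⟩
  ext x y
  exact congrFun (congrFun hV x) (i, y)

end Columns

/-! ### Tensor products of families of operators -/

section PiOp

variable {ι : Type*} [Fintype ι] {α : ι → Type*}

/-- Tensor product of a family of operators. -/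
def piOp (A : ∀ i, Matrix (α i) (α i) ℂ) : Matrix (∀ i, α i) (∀ i, α i) ℂ :=
  of fun x y => ∏ i, A i (x i) (y i)

theorem piOp_apply (A : ∀ i, Matrix (α i) (α i) ℂ) (x y : ∀ i, α i) :
    piOp A x y = ∏ i, A i (x i) (y i) := rfl

theorem conjTranspose_piOp (A : ∀ i, Matrix (α i) (α i) ℂ) :
    (piOp A)ᴴ = piOp fun i => (A i)ᴴ := by
  ext x y
  simp [piOp_apply]

variable [DecidableEq ι]

theorem piOp_update_sub (A : ∀ i, Matrix (α i) (α i) ℂ) (j : ι) (X Y : Matrix (α j) (α j) ℂ) :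
    piOp (Function.update A j (X - Y)) =
      piOp (Function.update A j X) - piOp (Function.update A j Y) := by
  ext x y
  have h : ∀ Z : Matrix (α j) (α j) ℂ, piOp (Function.update A j Z) x y =
      Z (x j) (y j) * ∏ i ∈ Finset.univ.erase j, A i (x i) (y i) := by
    intro Z
    rw [piOp_apply, ← Finset.mul_prod_erase _ _ (Finset.mem_univ j), Function.update_self]
    congr 1
    refine Finset.prod_congr rfl fun i hi => ?_
    rw [Function.update_of_ne (Finset.ne_of_mem_erase hi)]
  rw [Matrix.sub_apply, h, h, h, Matrix.sub_apply, sub_mul]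

variable [∀ i, Fintype (α i)]

theorem piOp_mul (A B : ∀ i, Matrix (α i) (α i) ℂ) :
    piOp A * piOp B = piOp fun i => A i * B i := by
  ext x y
  simp only [mul_apply, piOp_apply, ← Finset.prod_mul_distrib, Finset.prod_univ_sum,
    Fintype.piFinset_univ]

theorem trace_piOp (A : ∀ i, Matrix (α i) (α i) ℂ) : (piOp A).trace = ∏ i, (A i).trace := by
  simp only [trace, diag, piOp_apply, Finset.prod_univ_sum, Fintype.piFinset_univ]

variable [∀ i, DecidableEq (α i)]

theorem piOp_nonneg {A : ∀ i, Matrix (α i) (α i) ℂ} (hA : ∀ i, 0 ≤ A i) : 0 ≤ piOp A := by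
  have : piOp A = piOp (fun i => CFC.sqrt (A i)) * (piOp fun i => CFC.sqrt (A i))ᴴ := by
    rw [conjTranspose_piOp, piOp_mul]
    exact congrArg piOp (funext fun i => (sqrt_mul_conjTranspose_sqrt (hA i)).symm)
  rw [this]
  exact self_mul_conjTranspose_nonneg _

theorem isState_piOp {A : ∀ i, Matrix (α i) (α i) ℂ} (hA : ∀ i, IsState (A i)) :
    IsState (piOp A) :=
  ⟨nonneg_iff_posSemidef.1 (piOp_nonneg fun i => nonneg_iff_posSemidef.2 (hA i).1), by
    rw [trace_piOp]; exact Finset.prod_eq_one fun i _ => (hA i).2⟩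

theorem piOp_update_mono {A : ∀ i, Matrix (α i) (α i) ℂ} (hA : ∀ i, 0 ≤ A i) (j : ι)
    {X Y : Matrix (α j) (α j) ℂ} (h : X ≤ Y) :
    piOp (Function.update A j X) ≤ piOp (Function.update A j Y) := by
  rw [← sub_nonneg, ← piOp_update_sub]
  refine piOp_nonneg fun i => ?_
  rcases eq_or_ne i j with rfl | hi
  · rw [Function.update_self]; exact sub_nonneg.2 h
  · rw [Function.update_of_ne hi]; exact hA i

end PiOp

theorem isState_average {ι n : Type*} [Fintype ι] [Nonempty ι] [Fintype n]
    {A : ι → Matrix n n ℂ} (hA : ∀ i, IsState (A i)) :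
    IsState ((Fintype.card ι : ℝ)⁻¹ • ∑ i, A i) := by
  constructor
  · rw [← nonneg_iff_posSemidef]
    exact smul_nonneg (by positivity) (Finset.sum_nonneg fun i _ =>
      nonneg_iff_posSemidef.2 (hA i).1)
  · have h : (Fintype.card ι : ℂ) ≠ 0 := Nat.cast_ne_zero.2 Fintype.card_ne_zero
    rw [trace_smul, trace_sum, Finset.sum_congr rfl fun i _ => (hA i).2]
    simp [h]

/-! ### The convex-split lemma -/

section ConvexSplit

theorem isState_update {ι α : Type*} [DecidableEq ι] [Fintype α] {ρ σ : Matrix α α ℂ}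
    (hρ : IsState ρ) (hσ : IsState σ) (j i : ι) :
    IsState (Function.update (fun _ : ι => σ) j ρ i) := by
  rcases eq_or_ne i j with rfl | hi
  · rwa [Function.update_self]
  · rwa [Function.update_of_ne hi]

variable (ι : Type*) [Fintype ι] [DecidableEq ι] {α : Type*} [Fintype α] [DecidableEq α]

/-- The uniform mixture over `j` of `ρ` at position `j` and `σ` at all other positions. -/
def splitState (ρ σ : Matrix α α ℂ) : Matrix (ι → α) (ι → α) ℂ :=
  (Fintype.card ι : ℝ)⁻¹ • ∑ j, piOp (Function.update (fun _ : ι => σ) j ρ)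

theorem isState_splitState [Nonempty ι] {ρ σ : Matrix α α ℂ} (hρ : IsState ρ) (hσ : IsState σ) :
    IsState (splitState ι ρ σ) :=
  isState_average fun j => isState_piOp (isState_update hρ hσ j)

/-- The block for position `j` carries an optimal factor there and `√σ` elsewhere. Each other
position contributes trace one, so every block has the same overlap as the pair `ρ`, `ρ'`. -/
theorem fidelity_le_fidelity_splitState [Nonempty ι] {ρ ρ' σ : Matrix α α ℂ} (hρ : IsState ρ)
    (hρ' : IsState ρ') (hσ : IsState σ) :
    fidelity ρ ρ' ≤ fidelity (splitState ι ρ σ) (splitState ι ρ' σ) := by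
  have hρ0 := nonneg_iff_posSemidef.2 hρ.1
  have hσ0 := nonneg_iff_posSemidef.2 hσ.1
  obtain ⟨B, hB, hF⟩ := exists_re_trace_eq_fidelity ρ (nonneg_iff_posSemidef.2 hρ'.1)
  have hn : (Fintype.card ι : ℝ) ≠ 0 := Nat.cast_ne_zero.2 Fintype.card_ne_zero
  set c : ℝ := Real.sqrt (Fintype.card ι : ℝ)⁻¹ with hc
  have hcc : c * c = (Fintype.card ι : ℝ)⁻¹ := Real.mul_self_sqrt (by positivity)
  set q := fun _ : ι => CFC.sqrt σ with hq
  have key : ∀ X Y : Matrix α α ℂ, ∀ j : ι,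
      (c • piOp (Function.update q j X)) * (c • piOp (Function.update q j Y))ᴴ =
        (Fintype.card ι : ℝ)⁻¹ • piOp (Function.update (fun _ : ι => σ) j (X * Yᴴ)) := by
    intro X Y j
    rw [conjTranspose_smul, Matrix.smul_mul, Matrix.mul_smul, smul_smul, star_trivial, hcc,
      conjTranspose_piOp, piOp_mul]
    congr 2
    funext i
    rcases eq_or_ne i j with rfl | hi
    · simp
    · simp only [Function.update_of_ne hi, hq]
      exact sqrt_mul_conjTranspose_sqrt hσ0
  have h := sum_re_trace_le_fidelity (ρ := splitState ι ρ σ) (σ := splitState ι ρ' σ)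
    (A := fun j => c • piOp (Function.update q j (CFC.sqrt ρ)))
    (B := fun j => c • piOp (Function.update q j B))
    (by
      simp only [key, sqrt_mul_conjTranspose_sqrt hρ0, ← Finset.smul_sum]
      exact le_rfl)
    (by
      simp only [key, ← Finset.smul_sum]
      refine smul_le_smul_of_nonneg_left ?_ (by positivity)
      exact Finset.sum_le_sum fun j _ => piOp_update_mono (fun _ => hσ0) j hB)
  simp only [key, trace_smul, trace_piOp] at h
  have h1 : ∀ j : ι, ∏ i, (Function.update (fun _ : ι => σ) j (CFC.sqrt ρ * Bᴴ) i).trace =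
      (CFC.sqrt ρ * Bᴴ).trace := by
    intro j
    rw [Finset.prod_eq_single j, Function.update_self]
    · intro i _ hi
      rw [Function.update_of_ne hi, hσ.2]
    · simp
  simp only [h1, Complex.smul_re, hF, Finset.sum_const, Finset.card_univ, smul_eq_mul,
    nsmul_eq_mul] at h
  rwa [← mul_assoc, mul_inv_cancel₀ hn, one_mul] at h

/-- Fidelity form of the convex-split lemma. -/
theorem inv_sqrt_le_fidelity_splitState [Nonempty ι] {ρ σ : Matrix α α ℂ} (hρ : IsState ρ)
    (hσ : IsState σ) {x : ℝ} (hx : 1 ≤ x) (h : ρ ≤ x • σ) :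
    (Real.sqrt (1 + (x - 1) / Fintype.card ι))⁻¹ ≤
      fidelity (splitState ι ρ σ) (piOp fun _ : ι => σ) := by
  have hρ0 := nonneg_iff_posSemidef.2 hρ.1
  have hσ0 := nonneg_iff_posSemidef.2 hσ.1
  have hn : (0 : ℝ) < Fintype.card ι := Nat.cast_pos.2 Fintype.card_pos
  have hx0 : 0 ≤ x := by linarith
  set s := CFC.sqrt σ with hs
  have hsh : sᴴ = s := conjTranspose_sqrt σ
  have hss : s * s = σ := CFC.sqrt_mul_sqrt_self σ hσ0
  -- Here `t = x W W†` plays the part of `σ^{-1/2} ρ σ^{-1/2}` without inverting `σ`: it satisfies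
  -- `0 ≤ t ≤ x` and `√σ t √σ = ρ`.
  obtain ⟨W, hW, hW1⟩ := exists_factor_of_le (S := Real.sqrt x • s) (A := CFC.sqrt ρ)
    (by rw [IsHermitian, conjTranspose_smul, hsh, star_trivial])
    (by rw [sqrt_mul_conjTranspose_sqrt hρ0, Matrix.smul_mul, Matrix.mul_smul, smul_smul, hss,
          Real.mul_self_sqrt hx0]; exact h)
  set t : Matrix α α ℂ := x • (W * Wᴴ) with ht
  have ht0 : 0 ≤ t := smul_nonneg hx0 (self_mul_conjTranspose_nonneg W)
  have htx : 0 ≤ x • (1 : Matrix α α ℂ) - t := by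
    rw [ht, ← smul_sub]; exact smul_nonneg hx0 (sub_nonneg.2 hW1)
  have hst : s * t * s = ρ := by
    rw [← sqrt_mul_conjTranspose_sqrt hρ0, hW, conjTranspose_mul, conjTranspose_smul, hsh,
      star_trivial, ht]
    simp only [Matrix.mul_smul, Matrix.smul_mul, smul_smul, Real.mul_self_sqrt hx0,
      Matrix.mul_assoc]
  -- From `√t (x - t) √t ≥ 0` follows `t² ≤ x t`, and `Tr √σ t √σ = 1`.
  have hstt : (s * (t * t) * s).trace.re ≤ x := by
    have h1 : 0 ≤ CFC.sqrt t * (x • (1 : Matrix α α ℂ) - t) * (CFC.sqrt t)ᴴ := conj_nonneg htx _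
    have h2 : CFC.sqrt t * (x • (1 : Matrix α α ℂ) - t) * (CFC.sqrt t)ᴴ = x • t - t * t := by
      rw [conjTranspose_sqrt, Matrix.mul_sub, Matrix.sub_mul, Matrix.mul_smul, Matrix.mul_one,
        Matrix.smul_mul, CFC.sqrt_mul_sqrt_self t ht0]
      congr 1
      nth_rw 2 [← CFC.sqrt_mul_sqrt_self t ht0]
      rw [← Matrix.mul_assoc, CFC.sqrt_mul_sqrt_self t ht0, Matrix.mul_assoc,
        CFC.sqrt_mul_sqrt_self t ht0]
    rw [h2] at h1
    have h3 := trace_re_nonneg (conj_nonneg h1 s)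
    rw [hsh, Matrix.mul_sub, Matrix.sub_mul, Matrix.mul_smul, Matrix.smul_mul, hst, trace_sub,
      trace_smul, hρ.2] at h3
    simp only [Complex.sub_re, Complex.smul_re, Complex.one_re, smul_eq_mul, mul_one] at h3
    linarith
  set e := fun j : ι => Function.update (fun _ : ι => (1 : Matrix α α ℂ)) j t with he
  set S := piOp fun _ : ι => s with hS
  set T : Matrix (ι → α) (ι → α) ℂ := (Fintype.card ι : ℝ)⁻¹ • ∑ j, piOp (e j) with hT
  have hSh : Sᴴ = S := by rw [hS, conjTranspose_piOp]; simp only [hsh]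
  have hT0 : 0 ≤ T := by
    refine smul_nonneg (by positivity) (Finset.sum_nonneg fun j _ => piOp_nonneg fun i => ?_)
    rcases eq_or_ne i j with rfl | hi
    · simp only [he, Function.update_self]; exact ht0
    · simp only [he, Function.update_of_ne hi]; exact zero_le_one
  have hST : S * T * Sᴴ = splitState ι ρ σ := by
    rw [hSh, hT, Matrix.mul_smul, Matrix.smul_mul, splitState, Matrix.mul_sum, Matrix.sum_mul]
    congr 1
    refine Finset.sum_congr rfl fun j _ => ?_
    rw [hS, piOp_mul, piOp_mul]
    congr 1; funext i
    rcases eq_or_ne i j with rfl | hi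
    · simp only [he, Function.update_self, hst]
    · simp only [he, Function.update_of_ne hi, Matrix.mul_one, hss]
  -- Distinct positions factorize and give `1`, equal positions give at most `x`. With `N` positions
  -- the average over pairs is at most `(N x + N (N - 1)) / N² = 1 + (x - 1) / N`.
  have hpair : ∀ i j : ι, (S * (piOp (e i) * piOp (e j)) * S).trace.re ≤
      if i = j then x else 1 := by
    intro i j
    rw [hS, piOp_mul, piOp_mul, piOp_mul, trace_piOp]
    split_ifs with hij
    · subst hij
      rw [Finset.prod_eq_single i]
      · simpa only [he, Function.update_self] using hstt
      · intro l _ hl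
        simp only [he, Function.update_of_ne hl, Matrix.mul_one, hss, hσ.2]
      · simp
    · rw [Finset.prod_eq_one]
      · simp
      intro l _
      by_cases hi : l = i
      · subst hi
        simp only [he, Function.update_self, Function.update_of_ne hij, Matrix.mul_one, hst, hρ.2]
      by_cases hj : l = j
      · subst hj
        simp only [he, Function.update_self, Function.update_of_ne hi, Matrix.one_mul, hst, hρ.2]
      · simp only [he, Function.update_of_ne hi, Function.update_of_ne hj, Matrix.mul_one, hss,
          hσ.2]
  refine inv_sqrt_le_fidelity hT0 (S := S) ?_ hST ?_ (by
    have : 0 ≤ (x - 1) / Fintype.card ι := div_nonneg (by linarith) hn.le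
    linarith) ?_
  · rw [hSh, hS, piOp_mul]; simp only [hss]
  · rw [(isState_splitState ι hρ hσ).2]; rfl
  · rw [hSh, hT, Matrix.smul_mul, Matrix.mul_smul, Matrix.mul_smul, Matrix.mul_smul,
      Matrix.smul_mul, Matrix.smul_mul, smul_smul, Matrix.sum_mul, Matrix.mul_sum, Matrix.sum_mul,
      trace_smul, Complex.smul_re, trace_sum, Complex.re_sum, smul_eq_mul]
    simp only [Matrix.mul_sum, Matrix.sum_mul, trace_sum, Complex.re_sum]
    have h1 : ∑ i, ∑ j, (S * (piOp (e i) * piOp (e j)) * S).trace.re ≤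
        ∑ i : ι, ∑ j : ι, ((if i = j then x - 1 else 0) + 1) :=
      Finset.sum_le_sum fun i _ => Finset.sum_le_sum fun j _ => (hpair i j).trans_eq (by
        split_ifs <;> ring)
    simp only [Finset.sum_add_distrib, Finset.sum_ite_eq, Finset.mem_univ, if_true,
      Finset.sum_const, Finset.card_univ, nsmul_eq_mul, mul_one] at h1
    refine (mul_le_mul_of_nonneg_left h1 (by positivity)).trans_eq ?_
    field_simp
    ring

/-- The intermediate state is the split state of `ρ'`. The convex-split bound reads `1 - F² ≤ (x -
1) / (N + x - 1)` for `N` positions; keeping the `x - 1` in the denominator leaves room for rounding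
`N` down. -/
theorem purifiedDist_splitState_le [Nonempty ι] {ρ ρ' σ : Matrix α α ℂ} (hρ : IsState ρ)
    (hρ' : IsState ρ') (hσ : IsState σ) {ε δ x : ℝ} (hε : purifiedDist ρ ρ' ≤ ε) (hδ : 0 ≤ δ)
    (hx : 1 ≤ x) (h : ρ' ≤ x • σ) (hn : x - 1 ≤ δ ^ 2 * (Fintype.card ι + x - 1)) :
    purifiedDist (splitState ι ρ σ) (piOp fun _ : ι => σ) ≤ ε + δ := by
  have hω : IsState (piOp fun _ : ι => σ) := isState_piOp fun _ => hσ
  refine (purifiedDist_triangle (isState_splitState ι hρ hσ) (isState_splitState ι hρ' hσ)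
    hω).trans (add_le_add ?_ ?_)
  · exact (purifiedDist_anti (fidelity_le_fidelity_splitState ι hρ hρ' hσ)).trans hε
  · have hc : (0 : ℝ) < Fintype.card ι := Nat.cast_pos.2 Fintype.card_pos
    have h1 := inv_sqrt_le_fidelity_splitState ι hρ' hσ hx h
    have hQ : 0 < 1 + (x - 1) / (Fintype.card ι : ℝ) := by
      have : 0 ≤ (x - 1) / (Fintype.card ι : ℝ) := div_nonneg (by linarith) hc.le
      linarith
    have h2 := pow_le_pow_left₀ (by positivity) h1 2
    rw [inv_pow, Real.sq_sqrt hQ.le] at h2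
    refine Real.sqrt_le_iff.2 ⟨hδ, ?_⟩
    have h3 : 1 - (1 + (x - 1) / (Fintype.card ι : ℝ))⁻¹ ≤ δ ^ 2 := by
      have h4 : 0 < (Fintype.card ι : ℝ) + x - 1 := by linarith
      have h5 : 1 - (1 + (x - 1) / (Fintype.card ι : ℝ))⁻¹ =
          (x - 1) / (Fintype.card ι + x - 1) := by
        have : 1 + (x - 1) / (Fintype.card ι : ℝ) = (Fintype.card ι + x - 1) / Fintype.card ι := by
          field_simp; ring
        rw [this]
        field_simp
        ring
      rw [h5, div_le_iff₀ h4]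
      exact hn
    linarith

end ConvexSplit

/-! ### Compactness and attainment of the minimum -/

section Attained

theorem re_trace_mul_conjTranspose_self {n m : Type*} [Fintype n] [Fintype m] (A : Matrix n m ℂ) :
    (A * Aᴴ).trace.re = ∑ i, ∑ j, ‖A i j‖ ^ 2 := by
  simp only [trace, diag, mul_apply, conjTranspose_apply, Complex.re_sum, Complex.star_def,
    Complex.mul_conj, Complex.normSq_eq_norm_sq, Complex.ofReal_re]

theorem isCompact_re_trace_le_one (n m : Type*) [Fintype n] [Fintype m] :
    IsCompact {A : Matrix n m ℂ | (A * Aᴴ).trace.re ≤ 1} := by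
  have hc : IsCompact (Set.pi Set.univ fun _ : n => Set.pi Set.univ fun _ : m =>
      Metric.closedBall (0 : ℂ) 1) :=
    isCompact_univ_pi fun _ => isCompact_univ_pi fun _ => isCompact_closedBall _ _
  refine IsCompact.of_isClosed_subset hc ?_ ?_
  · refine isClosed_le (Complex.continuous_re.comp ?_) continuous_const
    exact (continuous_id.matrix_mul continuous_id.matrix_conjTranspose).matrix_trace
  · intro A hA i _ j _
    rw [Set.mem_ofPred_eq, re_trace_mul_conjTranspose_self] at hA
    have h1 : ‖A i j‖ ^ 2 ≤ ∑ j, ‖A i j‖ ^ 2 :=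
      Finset.single_le_sum (f := fun j => ‖A i j‖ ^ 2) (fun _ _ => sq_nonneg _) (Finset.mem_univ j)
    have h2 : ∑ j, ‖A i j‖ ^ 2 ≤ ∑ i, ∑ j, ‖A i j‖ ^ 2 :=
      Finset.single_le_sum (f := fun i => ∑ j, ‖A i j‖ ^ 2)
        (fun _ _ => Finset.sum_nonneg fun _ _ => sq_nonneg _) (Finset.mem_univ i)
    rw [mem_closedBall_zero_iff]
    exact (sq_le_one_iff₀ (norm_nonneg _)).1 (by linarith)

variable {n : Type*} [Fintype n]

theorem isClosed_setOf_posSemidef : IsClosed {A : Matrix n n ℂ | A.PosSemidef} := by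
  have : {A : Matrix n n ℂ | A.PosSemidef} =
      {A | Aᴴ = A} ∩ ⋂ x : n → ℂ, {A | 0 ≤ star x ⬝ᵥ (A *ᵥ x)} := by
    ext A
    simp only [Set.mem_ofPred_eq, posSemidef_iff_dotProduct_mulVec, Set.mem_inter_iff,
      Set.mem_iInter]
    rfl
  rw [this]
  refine (isClosed_eq continuous_id.matrix_conjTranspose continuous_id).inter
    (isClosed_iInter fun x => isClosed_le continuous_const ?_)
  exact continuous_const.dotProduct (continuous_id.matrix_mulVec continuous_const)

theorem dmax_le {ρ σ : Matrix n n ℂ} {c : ℝ} (h : ρ ≤ ((2 : ℝ) ^ c) • σ) :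
    dmax ρ σ ≤ (c : EReal) := iInf₂_le c h

variable [DecidableEq n]

theorem isCompact_setOf_isState : IsCompact {A : Matrix n n ℂ | IsState A} := by
  have hC : IsCompact ((fun A : Matrix n n ℂ => A * Aᴴ) ''
      {A : Matrix n n ℂ | (A * Aᴴ).trace.re ≤ 1}) :=
    (isCompact_re_trace_le_one n n).image
      (continuous_id.matrix_mul continuous_id.matrix_conjTranspose)
  refine hC.of_isClosed_subset ?_ ?_
  · exact isClosed_setOf_posSemidef.inter
      (isClosed_eq continuous_id.matrix_trace continuous_const)
  · intro A hA
    have hA0 := nonneg_iff_posSemidef.2 hA.1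
    refine ⟨CFC.sqrt A, ?_, sqrt_mul_conjTranspose_sqrt hA0⟩
    rw [Set.mem_ofPred_eq, sqrt_mul_conjTranspose_sqrt hA0, hA.2]
    simp

/-- For `ε > 1` both sides hold, the real square root of a negative number being `0`. -/
theorem purifiedDist_le_iff {ρ σ : Matrix n n ℂ} {ε : ℝ} (hε : 0 ≤ ε) :
    purifiedDist ρ σ ≤ ε ↔ Real.sqrt (1 - ε ^ 2) ≤ fidelity ρ σ := by
  rw [purifiedDist, Real.sqrt_le_iff, Real.sqrt_le_iff]
  have := fidelity_nonneg ρ σ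
  constructor <;> rintro ⟨-, h⟩ <;> exact ⟨by assumption, by linarith⟩

theorem minDmax_le {ε : ℝ} {ρ ρ' σ : Matrix n n ℂ} {F : Set (Matrix n n ℂ)} (hσ : σ ∈ F)
    (hρ' : IsState ρ') (hd : purifiedDist ρ ρ' ≤ ε) {c : ℝ} (h : ρ' ≤ ((2 : ℝ) ^ c) • σ) :
    minDmax ε ρ F ≤ (c : EReal) :=
  (iInf₂_le σ hσ).trans ((iInf₂_le ρ' ⟨hρ', hd⟩).trans (dmax_le h))

/-- Both optimizations in `min_σ D_max^ε(ρ‖σ)` are attained. -/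
theorem exists_optimal {ε : ℝ} (hε : 0 ≤ ε) {ρ : Matrix n n ℂ} (hρ : IsState ρ)
    {F : Set (Matrix n n ℂ)} (hF : IsClosed F) (hFs : ∀ σ ∈ F, IsState σ)
    (hfin : minDmax ε ρ F < ⊤) :
    ∃ σ ∈ F, ∃ ρ', IsState ρ' ∧ purifiedDist ρ ρ' ≤ ε ∧
      ∀ c : ℝ, minDmax ε ρ F ≤ c → ρ' ≤ ((2 : ℝ) ^ c) • σ := by
  set k := minDmax ε ρ F with hk
  have hle : IsClosed {p : Matrix n n ℂ × Matrix n n ℂ | p.1 ≤ p.2} :=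
    isClosed_setOf_posSemidef.preimage (continuous_snd.sub continuous_fst)
  let X := Matrix n n ℂ × Matrix n n ℂ × Matrix n n ℂ
  -- The third component is a factor witnessing the fidelity bound. The constraint on the distance
  -- becomes closed in this factor, so continuity of the fidelity is not needed.
  let K : Set X := {p | IsState p.1 ∧ p.2.1 ∈ F ∧ p.2.2 * p.2.2ᴴ ≤ p.1 ∧
    Real.sqrt (1 - ε ^ 2) ≤ (CFC.sqrt ρ * p.2.2ᴴ).trace.re}
  have hBcont : Continuous fun p : X => p.2.2 := by fun_prop
  have hFc : IsCompact F := isCompact_setOf_isState.of_isClosed_subset hF hFs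
  have hK : IsCompact K := by
    refine (isCompact_setOf_isState.prod (hFc.prod (isCompact_re_trace_le_one n n))
      ).of_isClosed_subset ?_ ?_
    · refine IsClosed.inter (isCompact_setOf_isState.isClosed.preimage continuous_fst) ?_
      refine IsClosed.inter (hF.preimage (continuous_fst.comp continuous_snd)) ?_
      refine IsClosed.inter (hle.preimage
        ((hBcont.matrix_mul hBcont.matrix_conjTranspose).prodMk continuous_fst)) ?_
      exact isClosed_le continuous_const (Complex.continuous_re.comp
        (continuous_const.matrix_mul hBcont.matrix_conjTranspose).matrix_trace)
    · rintro ⟨A, B, C⟩ ⟨hA, hB, hC, -⟩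
      refine ⟨hA, hB, (trace_re_mono hC).trans ?_⟩
      rw [hA.2]; simp
  -- Nested nonempty compact sets: a common point is feasible for every `c > k`, and the value `c =
  -- k` follows by letting `c` decrease.
  let S : {c : ℝ // k < c} → Set X := fun c => K ∩ {p | p.1 ≤ ((2 : ℝ) ^ c.1) • p.2.1}
  have hSclosed : ∀ c : {c : ℝ // k < c}, IsClosed {p : X | p.1 ≤ ((2 : ℝ) ^ c.1) • p.2.1} := by
    intro c
    refine hle.preimage (f := fun p : X => (p.1, ((2 : ℝ) ^ c.1) • p.2.1)) ?_
    fun_prop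
  have hmono : ∀ {c d : ℝ} {A B : Matrix n n ℂ}, c ≤ d → IsState B → A ≤ ((2 : ℝ) ^ c) • B →
      A ≤ ((2 : ℝ) ^ d) • B := by
    intro c d A B hcd hB h
    refine h.trans (smul_le_smul_of_nonneg_right ?_ (nonneg_iff_posSemidef.2 hB.1))
    exact Real.rpow_le_rpow_of_exponent_le one_le_two hcd
  have hne : ∀ c, (S c).Nonempty := by
    rintro ⟨c, hc⟩
    have hc₁ := hc
    simp only [hk, minDmax, dmaxSmooth, dmax, iInf_lt_iff] at hc₁
    obtain ⟨σ, hσ, ρ', ⟨hρ', hd⟩, c', hc', h3⟩ := hc₁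
    obtain ⟨B, hB, hBF⟩ := exists_re_trace_eq_fidelity ρ (nonneg_iff_posSemidef.2 hρ'.1)
    refine ⟨(ρ', σ, B), ⟨hρ', hσ, hB, ?_⟩, ?_⟩
    · rw [hBF]; exact (purifiedDist_le_iff hε).1 hd
    · exact hmono (EReal.coe_lt_coe_iff.1 h3).le (hFs σ hσ) hc'
  have hdir : Directed (· ⊇ ·) S := by
    intro c d
    rcases le_total c.1 d.1 with h | h
    · exact ⟨c, subset_rfl, fun p hp => ⟨hp.1, hmono h (hFs _ hp.1.2.1) hp.2⟩⟩
    · exact ⟨d, fun p hp => ⟨hp.1, hmono h (hFs _ hp.1.2.1) hp.2⟩, subset_rfl⟩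
  obtain ⟨c₀, hc₀, -⟩ := EReal.lt_iff_exists_real_btwn.1 hfin
  have : Nonempty {c : ℝ // k < c} := ⟨⟨c₀, hc₀⟩⟩
  obtain ⟨⟨ρ', σ, B⟩, hp⟩ := IsCompact.nonempty_iInter_of_directed_nonempty_isCompact_isClosed S
    hdir hne (fun c => hK.inter_right (hSclosed c)) (fun c => hK.isClosed.inter (hSclosed c))
  rw [Set.mem_iInter] at hp
  obtain ⟨hρ', hσ, hB, hBF⟩ := (hp ⟨c₀, hc₀⟩).1
  refine ⟨σ, hσ, ρ', hρ', (purifiedDist_le_iff hε).2 (hBF.trans ?_), fun c hc => ?_⟩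
  · exact re_trace_le_fidelity (sqrt_mul_conjTranspose_sqrt (nonneg_iff_posSemidef.2 hρ.1)).le hB
  · have hlim : Filter.Tendsto (fun d : ℝ => (ρ', ((2 : ℝ) ^ d) • σ)) (nhdsWithin c (Set.Ioi c))
        (nhds (ρ', ((2 : ℝ) ^ c) • σ)) := by
      refine Filter.Tendsto.mono_left ?_ nhdsWithin_le_nhds
      have : Continuous fun d : ℝ => (ρ', ((2 : ℝ) ^ d) • σ) := by
        have h2 : Continuous fun d : ℝ => (2 : ℝ) ^ d := Real.continuous_const_rpow two_ne_zero
        fun_prop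
      exact this.tendsto c
    refine hle.mem_of_tendsto hlim ?_
    filter_upwards [self_mem_nhdsWithin] with d hd
    exact (hp ⟨d, hc.trans_lt (EReal.coe_lt_coe_iff.2 hd)⟩).2

theorem exists_dmaxSmooth_eq_minDmax {ε : ℝ} (hε : 0 ≤ ε) {ρ : Matrix n n ℂ} (hρ : IsState ρ)
    {F : Set (Matrix n n ℂ)} (hF : IsClosed F) (hFs : ∀ σ ∈ F, IsState σ) (hne : F.Nonempty) :
    ∃ σ ∈ F, dmaxSmooth ε ρ σ = minDmax ε ρ F := by
  rcases (le_top : minDmax ε ρ F ≤ ⊤).lt_or_eq with h | h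
  · obtain ⟨σ, hσ, ρ', hρ', hd, hc⟩ := exists_optimal hε hρ hF hFs h
    refine ⟨σ, hσ, le_antisymm ?_ (iInf₂_le σ hσ)⟩
    refine EReal.le_of_forall_lt_iff_le.1 fun c hk => ?_
    exact (iInf₂_le ρ' ⟨hρ', hd⟩).trans (dmax_le (hc c hk.le))
  · obtain ⟨σ, hσ⟩ := hne
    refine ⟨σ, hσ, le_antisymm (le_top.trans h.ge) (iInf₂_le σ hσ)⟩

end Attained

/-! ### Invariance under relabelling and unitaries -/

section Reindex

variable {n m l : Type*} [Fintype n] [Fintype m]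

theorem submatrix_mono {n m : Type*} {A B : Matrix n n ℂ} (h : A ≤ B) (e : m → n) :
    A.submatrix e e ≤ B.submatrix e e := by
  exact (Matrix.le_iff.1 h).submatrix e

theorem isState_submatrix {A : Matrix n n ℂ} (hA : IsState A) (e : m ≃ n) :
    IsState (A.submatrix e e) :=
  ⟨hA.1.submatrix e, by
    rw [← hA.2]
    exact Equiv.sum_comp e fun i => A i i⟩

theorem isState_conj [DecidableEq n] {A U : Matrix n n ℂ} (hA : IsState A) (hU : Uᴴ * U = 1) :
    IsState (U * A * Uᴴ) :=
  ⟨hA.1.mul_mul_conjTranspose_same U, by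
    rw [trace_mul_comm, ← Matrix.mul_assoc, hU, Matrix.one_mul, hA.2]⟩

variable [DecidableEq n] [DecidableEq m]

theorem fidelity_le_fidelity_submatrix {ρ σ : Matrix n n ℂ} (hρ : 0 ≤ ρ) (hσ : 0 ≤ σ)
    (e : m ≃ n) : fidelity ρ σ ≤ fidelity (ρ.submatrix e e) (σ.submatrix e e) := by
  obtain ⟨B, hB, h⟩ := exists_re_trace_eq_fidelity ρ hσ
  have key : ∀ X Y : Matrix n n ℂ,
      X.submatrix e id * (Y.submatrix e id)ᴴ = (X * Yᴴ).submatrix e e := fun X Y => rfl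
  have := re_trace_le_fidelity (ρ := ρ.submatrix e e) (σ := σ.submatrix e e)
    (A := (CFC.sqrt ρ).submatrix e id) (B := B.submatrix e id)
    (by rw [key, sqrt_mul_conjTranspose_sqrt hρ]) (by rw [key]; exact submatrix_mono hB e)
  rw [key] at this
  rw [← h]
  convert this using 2
  exact (Equiv.sum_comp e fun i => (CFC.sqrt ρ * Bᴴ) i i).symm

theorem fidelity_le_fidelity_conj {ρ σ U : Matrix n n ℂ} (hρ : 0 ≤ ρ) (hσ : 0 ≤ σ)
    (hU : Uᴴ * U = 1) : fidelity ρ σ ≤ fidelity (U * ρ * Uᴴ) (U * σ * Uᴴ) := by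
  obtain ⟨B, hB, h⟩ := exists_re_trace_eq_fidelity ρ hσ
  have key : ∀ X Y : Matrix n n ℂ, U * X * (U * Y)ᴴ = U * (X * Yᴴ) * Uᴴ := by
    intro X Y
    rw [conjTranspose_mul]
    simp only [Matrix.mul_assoc]
  have := re_trace_le_fidelity (ρ := U * ρ * Uᴴ) (σ := U * σ * Uᴴ)
    (A := U * CFC.sqrt ρ) (B := U * B)
    (by rw [key, sqrt_mul_conjTranspose_sqrt hρ]) (by rw [key]; exact conj_mono hB U)
  rwa [key, trace_mul_comm, ← Matrix.mul_assoc, hU, Matrix.one_mul, h] at this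

end Reindex

/-! ### Calculus on registers: partial traces, tensor products, controlled operators -/

namespace Framework

variable {t : ℕ} {R : RegisterSystem.{u} t} {M : R.Kind} {fw : Framework R M}
  {K L N : Finset (Slot fw.m)}

theorem restr_glue (h : K ⊆ N) (x : fw.Idx K) (z : fw.Idx (N \ K)) : restr h (glue x z) = x := by
  funext s
  simp [restr, glue]

theorem restr_sdiff_glue (x : fw.Idx K) (z : fw.Idx (N \ K)) :
    restr Finset.sdiff_subset (glue x z) = z := by
  funext s
  simp [restr, glue, (Finset.mem_sdiff.1 s.2).2]

theorem glue_restr (h : K ⊆ N) (x : fw.Idx N) :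
    glue (restr h x) (restr Finset.sdiff_subset x) = x := by
  funext s
  simp [restr, glue]

/-- Splitting of the labels on `N` into labels on `K` and on `N \ K`. -/
def glueEquiv (h : K ⊆ N) : fw.Idx K × fw.Idx (N \ K) ≃ fw.Idx N where
  toFun p := glue p.1 p.2
  invFun x := (restr h x, restr Finset.sdiff_subset x)
  left_inv p := Prod.ext (restr_glue h p.1 p.2) (restr_sdiff_glue p.1 p.2)
  right_inv x := glue_restr h x

theorem sum_idx {β : Type*} [AddCommMonoid β] (h : K ⊆ N) (f : fw.Idx N → β) :
    ∑ x, f x = ∑ x : fw.Idx K, ∑ z : fw.Idx (N \ K), f (glue x z) := by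
  rw [← Fintype.sum_prod_type', ← Equiv.sum_comp (glueEquiv h)]
  rfl

/-! Partial traces -/

theorem trace_ptrace (h : K ⊆ N) (A : fw.Op N) : (ptrace K A).trace = A.trace := by
  simp only [trace, diag]
  rw [sum_idx h]
  rfl

theorem ptrace_sub (A B : fw.Op N) : ptrace K (A - B) = ptrace K A - ptrace K B := by
  ext x y
  simp [ptrace]

theorem ptrace_sum {ι : Type*} (s : Finset ι) (A : ι → fw.Op N) :
    ptrace K (∑ i ∈ s, A i) = ∑ i ∈ s, ptrace K (A i) := by
  ext x y
  simp only [ptrace, Matrix.sum_apply, of_apply]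
  exact Finset.sum_comm

theorem ptrace_smul (c : ℝ) (A : fw.Op N) : ptrace K (c • A) = c • ptrace K A := by
  ext x y
  simp only [ptrace, of_apply, Matrix.smul_apply, Finset.smul_sum]

/-- The rows outside `K` turned into columns. -/
def reshape {m : Type*} (K : Finset (Slot fw.m)) (A : Matrix (fw.Idx N) m ℂ) :
    Matrix (fw.Idx K) (fw.Idx (N \ K) × m) ℂ :=
  of fun x p => A (glue x p.1) p.2

/-- The registers traced out join the purifying columns. Positivity of the partial trace and
monotonicity of the fidelity both come from this. -/
theorem ptrace_mul_conjTranspose {m : Type*} [Fintype m] (A B : Matrix (fw.Idx N) m ℂ) :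
    ptrace K (A * Bᴴ) = reshape K A * (reshape K B)ᴴ := by
  ext x y
  simp [ptrace, reshape, mul_apply, Fintype.sum_prod_type]

theorem ptrace_nonneg {A : fw.Op N} (hA : 0 ≤ A) : 0 ≤ ptrace K A := by
  rw [← sqrt_mul_conjTranspose_sqrt hA, ptrace_mul_conjTranspose]
  exact self_mul_conjTranspose_nonneg _

theorem ptrace_mono {A B : fw.Op N} (h : A ≤ B) : ptrace K A ≤ ptrace K B := by
  rw [← sub_nonneg, ← ptrace_sub]
  exact ptrace_nonneg (sub_nonneg.2 h)

theorem isState_ptrace (h : K ⊆ N) {A : fw.Op N} (hA : IsState A) : IsState (ptrace K A) :=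
  ⟨nonneg_iff_posSemidef.1 (ptrace_nonneg (nonneg_iff_posSemidef.2 hA.1)), by
    rw [trace_ptrace h, hA.2]⟩

theorem fidelity_le_fidelity_ptrace (h : K ⊆ N) {ρ σ : fw.Op N} (hρ : 0 ≤ ρ) (hσ : 0 ≤ σ) :
    fidelity ρ σ ≤ fidelity (ptrace K ρ) (ptrace K σ) := by
  obtain ⟨B, hB, hF⟩ := exists_re_trace_eq_fidelity ρ hσ
  have := re_trace_le_fidelity (ρ := ptrace K ρ) (σ := ptrace K σ)
    (A := reshape K (CFC.sqrt ρ)) (B := reshape K B)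
    (by rw [← ptrace_mul_conjTranspose, sqrt_mul_conjTranspose_sqrt hρ])
    (by rw [← ptrace_mul_conjTranspose]; exact ptrace_mono hB)
  rwa [← ptrace_mul_conjTranspose, trace_ptrace h, hF] at this

/-! Tensor products -/

theorem conjTranspose_tensor (hK : K ⊆ N) (hL : L ⊆ N) (A : fw.Op K) (B : fw.Op L) :
    (tensor hK hL A B)ᴴ = tensor hK hL Aᴴ Bᴴ := by
  ext x y
  simp [tensor]

theorem ptrace_tensor (hK : K ⊆ N) (hL : L ⊆ N) (h : L = N \ K) (A : fw.Op K) (B : fw.Op L) :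
    ptrace K (tensor hK hL A B) = B.trace • A := by
  subst h
  ext x y
  simp only [ptrace, tensor, of_apply, restr_glue, restr_sdiff_glue, Matrix.smul_apply, smul_eq_mul,
    trace, diag, mul_comm, Finset.mul_sum]

theorem tensor_mul (hK : K ⊆ N) (hL : L ⊆ N) (h : L = N \ K) (A A' : fw.Op K) (B B' : fw.Op L) :
    tensor hK hL A B * tensor hK hL A' B' = tensor hK hL (A * A') (B * B') := by
  subst h
  ext x y
  rw [mul_apply, sum_idx hK]
  simp only [tensor, of_apply, restr_glue, restr_sdiff_glue, mul_apply, Finset.sum_mul_sum]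
  refine Finset.sum_congr rfl fun i _ => Finset.sum_congr rfl fun j _ => ?_
  ring

theorem tensor_nonneg (hK : K ⊆ N) (hL : L ⊆ N) (h : L = N \ K) {A : fw.Op K} {B : fw.Op L}
    (hA : 0 ≤ A) (hB : 0 ≤ B) : 0 ≤ tensor hK hL A B := by
  rw [← sqrt_mul_conjTranspose_sqrt hA, ← sqrt_mul_conjTranspose_sqrt hB, ← tensor_mul hK hL h,
    ← conjTranspose_tensor]
  exact self_mul_conjTranspose_nonneg _

/-! Single registers -/

/-- Labels on the one-element collection `{s}` are labels of the register at `s`. -/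
def singleEquiv (s : Slot fw.m) : fw.Idx {s} ≃ fw.Space s where
  toFun x := x ⟨s, Finset.mem_singleton_self s⟩
  invFun v := fun s' => (Finset.mem_singleton.1 s'.2).symm ▸ v
  left_inv x := by
    funext ⟨s', h⟩
    obtain rfl := Finset.mem_singleton.1 h
    rfl
  right_inv v := rfl

theorem lift_eq_submatrix (s : Slot fw.m) (A : Matrix (fw.Space s) (fw.Space s) ℂ) :
    lift s A = A.submatrix (singleEquiv s) (singleEquiv s) := rfl

theorem lift_submatrix_symm (s : Slot fw.m) (A : fw.Op {s}) :
    lift s (A.submatrix (singleEquiv s).symm (singleEquiv s).symm) = A := by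
  rw [lift_eq_submatrix, submatrix_submatrix]
  simp

theorem lift_submatrix_symm' (s : Slot fw.m) (A : Matrix (fw.Space s) (fw.Space s) ℂ) :
    (lift s A).submatrix (singleEquiv s).symm (singleEquiv s).symm = A := by
  rw [lift_eq_submatrix, submatrix_submatrix]
  simp

theorem isState_lift_iff (s : Slot fw.m) (A : Matrix (fw.Space s) (fw.Space s) ℂ) :
    IsState (lift s A) ↔ IsState A := by
  constructor
  · intro h
    have := isState_submatrix h (singleEquiv s).symm
    rwa [lift_submatrix_symm'] at this
  · exact fun h => isState_submatrix h (singleEquiv s)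

/-! Operators controlled by the last register -/

variable (fw) in
theorem rand_eq_sdiff : ({Slot.rand} : Finset (Slot fw.m)) = Finset.univ \ fw.ME := by
  ext s; simp

theorem conjTranspose_ketbra (k : Fin fw.ell) : (fw.ketbra k)ᴴ = fw.ketbra k := by
  rw [ketbra, lift_eq_submatrix, conjTranspose_submatrix, conjTranspose_single, star_one]

theorem trace_ketbra (k : Fin fw.ell) : (fw.ketbra k).trace = 1 := by
  rw [ketbra, lift_eq_submatrix]
  trans (Matrix.single (fun _ => k) (fun _ => k) 1 :
    Matrix (fw.Space Slot.rand) (fw.Space Slot.rand) ℂ).trace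
  · exact Equiv.sum_comp (singleEquiv Slot.rand) fun i => (Matrix.single (fun _ => k) (fun _ => k) 1 :
      Matrix (fw.Space Slot.rand) (fw.Space Slot.rand) ℂ) i i
  · exact trace_single_eq_same _ _

/-- For `t = 0` all the vectors `|k^t⟩` would coincide; the need for `1 ≤ t` goes back to this. -/
theorem const_injective (ht : 1 ≤ t) {n : ℕ} :
    Function.Injective fun (k : Fin n) (_ : Fin t) => k :=
  fun _ _ h => congrFun h ⟨0, ht⟩

theorem ketbra_mul (ht : 1 ≤ t) (k l : Fin fw.ell) :
    fw.ketbra k * fw.ketbra l = if k = l then fw.ketbra k else 0 := by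
  rw [ketbra, ketbra, lift_eq_submatrix, lift_eq_submatrix, submatrix_mul_equiv]
  split_ifs with h
  · subst h
    rw [single_mul_single_same, one_mul]
  · rw [single_mul_single_of_ne _ _ _ _ (fun h' => h (const_injective ht h')), submatrix_zero]
    rfl

theorem conjTranspose_controlled (A : Fin fw.ell → fw.Op fw.ME) :
    (fw.controlled A)ᴴ = fw.controlled fun k => (A k)ᴴ := by
  rw [controlled, conjTranspose_sum]
  exact Finset.sum_congr rfl fun k _ => by rw [conjTranspose_tensor, conjTranspose_ketbra]

theorem controlled_mul (ht : 1 ≤ t) (A B : Fin fw.ell → fw.Op fw.ME) :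
    fw.controlled A * fw.controlled B = fw.controlled fun k => A k * B k := by
  rw [controlled, controlled, Finset.sum_mul_sum]
  refine Finset.sum_congr rfl fun k _ => ?_
  rw [Finset.sum_eq_single k]
  · rw [tensor_mul _ _ fw.rand_eq_sdiff, ketbra_mul ht, if_pos rfl]
  · intro l _ hl
    rw [tensor_mul _ _ fw.rand_eq_sdiff, ketbra_mul ht, if_neg hl.symm]
    ext x y
    simp [tensor]
  · simp

theorem ptrace_controlled (A : Fin fw.ell → fw.Op fw.ME) :
    ptrace fw.ME (fw.controlled A) = ∑ k, A k := by
  rw [controlled, ptrace_sum]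
  exact Finset.sum_congr rfl fun k _ => by
    rw [ptrace_tensor _ _ fw.rand_eq_sdiff, trace_ketbra, one_smul]

theorem trace_controlled (A : Fin fw.ell → fw.Op fw.ME) :
    (fw.controlled A).trace = ∑ k, (A k).trace := by
  rw [← trace_ptrace (Finset.subset_univ fw.ME), ptrace_controlled, trace_sum]

theorem controlled_add (A B : Fin fw.ell → fw.Op fw.ME) :
    fw.controlled (A + B) = fw.controlled A + fw.controlled B := by
  rw [controlled, controlled, controlled, ← Finset.sum_add_distrib]
  refine Finset.sum_congr rfl fun k _ => ?_
  ext x y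
  simp [tensor, add_mul]

theorem controlled_nonneg (ht : 1 ≤ t) {A : Fin fw.ell → fw.Op fw.ME} (hA : ∀ k, 0 ≤ A k) :
    0 ≤ fw.controlled A := by
  have : fw.controlled A = fw.controlled (fun k => CFC.sqrt (A k)) *
      (fw.controlled fun k => CFC.sqrt (A k))ᴴ := by
    rw [conjTranspose_controlled, controlled_mul ht]
    exact congrArg fw.controlled (funext fun k => (sqrt_mul_conjTranspose_sqrt (hA k)).symm)
  rw [this]
  exact self_mul_conjTranspose_nonneg _

theorem controlled_mono (ht : 1 ≤ t) {A B : Fin fw.ell → fw.Op fw.ME} (h : ∀ k, A k ≤ B k) :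
    fw.controlled A ≤ fw.controlled B := by
  have h1 : fw.controlled B = fw.controlled (fun k => B k - A k) + fw.controlled A := by
    rw [← controlled_add]
    exact congrArg fw.controlled (funext fun k => (sub_add_cancel (B k) (A k)).symm)
  rw [h1]
  exact le_add_of_nonneg_left (controlled_nonneg ht fun k => sub_nonneg.2 (h k))

theorem sum_re_trace_le_fidelity_controlled (ht : 1 ≤ t) {ρ σ A B : Fin fw.ell → fw.Op fw.ME}
    (hA : ∀ k, A k * (A k)ᴴ ≤ ρ k) (hB : ∀ k, B k * (B k)ᴴ ≤ σ k) :
    ∑ k, (A k * (B k)ᴴ).trace.re ≤ fidelity (fw.controlled ρ) (fw.controlled σ) := by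
  have := re_trace_le_fidelity (ρ := fw.controlled ρ) (σ := fw.controlled σ)
    (A := fw.controlled A) (B := fw.controlled B)
    (by rw [conjTranspose_controlled, controlled_mul ht]; exact controlled_mono ht hA)
    (by rw [conjTranspose_controlled, controlled_mul ht]; exact controlled_mono ht hB)
  rwa [conjTranspose_controlled, controlled_mul ht, trace_controlled, Complex.re_sum] at this

/-- The label on all registers with part `a` on `M E` and `k` in all parts of the last register. -/
def extend (a : fw.Idx fw.ME) (k : Fin fw.ell) : fw.Idx Finset.univ
  | ⟨.sys, _⟩ => a ⟨.sys, by simp⟩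
  | ⟨.cat i, _⟩ => a ⟨.cat i, by simp⟩
  | ⟨.rand, _⟩ => fun _ => k

theorem extend_restr {x : fw.Idx Finset.univ} {k : Fin fw.ell}
    (hx : x ⟨.rand, Finset.mem_univ _⟩ = fun _ => k) :
    extend (restr (Finset.subset_univ fw.ME) x) k = x := by
  funext ⟨s, hs⟩
  cases s with
  | sys => rfl
  | cat i => rfl
  | rand => exact hx.symm

/-- The entry of the label pair `x`, `y` lies in one of the blocks of controlled operators. -/
def InBlock (x y : fw.Idx Finset.univ) : Prop :=
  ∃ k : Fin fw.ell, (x ⟨.rand, Finset.mem_univ _⟩ = fun _ => k) ∧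
    (y ⟨.rand, Finset.mem_univ _⟩ = fun _ => k)

theorem ketbra_apply (k : Fin fw.ell) (x y : fw.Idx {Slot.rand}) :
    fw.ketbra k x y = if (fun _ => k) = x ⟨.rand, Finset.mem_singleton_self _⟩ ∧
      (fun _ => k) = y ⟨.rand, Finset.mem_singleton_self _⟩ then 1 else 0 := by
  rw [ketbra, lift, submatrix_apply, single_apply]

theorem controlled_apply_eq_zero (A : Fin fw.ell → fw.Op fw.ME) {x y : fw.Idx Finset.univ}
    (h : ¬ InBlock x y) : fw.controlled A x y = 0 := by
  rw [controlled, Matrix.sum_apply]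
  refine Finset.sum_eq_zero fun k _ => ?_
  rw [tensor, of_apply, ketbra_apply, if_neg, mul_zero]
  exact fun h' => h ⟨k, h'.1.symm, h'.2.symm⟩

theorem controlled_apply (ht : 1 ≤ t) (A : Fin fw.ell → fw.Op fw.ME) {x y : fw.Idx Finset.univ}
    {k : Fin fw.ell} (hx : x ⟨.rand, Finset.mem_univ _⟩ = fun _ => k)
    (hy : y ⟨.rand, Finset.mem_univ _⟩ = fun _ => k) :
    fw.controlled A x y = A k (restr (Finset.subset_univ fw.ME) x)
      (restr (Finset.subset_univ fw.ME) y) := by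
  rw [controlled, Matrix.sum_apply, Finset.sum_eq_single k]
  · rw [tensor, of_apply, ketbra_apply, if_pos ⟨hx.symm, hy.symm⟩, mul_one]
  · intro l _ hl
    rw [tensor, of_apply, ketbra_apply, if_neg, mul_zero]
    exact fun h' => hl (const_injective ht (h'.1.trans hx))
  · simp

theorem eq_controlled (ht : 1 ≤ t) {ω : fw.Op Finset.univ}
    (h : ∀ x y, ¬ InBlock x y → ω x y = 0) :
    ω = fw.controlled fun k => ω.submatrix (extend · k) (extend · k) := by
  ext x y
  by_cases hb : InBlock x y
  · obtain ⟨k, hx, hy⟩ := hb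
    rw [controlled_apply ht _ hx hy, submatrix_apply, extend_restr hx, extend_restr hy]
  · rw [h x y hb, controlled_apply_eq_zero _ hb]

end Framework

/-! ### Consequences of the axioms and the converse -/

namespace ResourceTheory

open Framework

variable {t : ℕ} {R : RegisterSystem.{u} t} {T : ResourceTheory R} {M : R.Kind}
  {fw : Framework R M}

/-- The axioms speak about frameworks only; the smallest one, with no register between `M` and a
last register of dimension one, transfers them to the single register. -/
theorem isState_of_mem_single {A : Matrix (R.Basis M) (R.Basis M) ℂ} (hA : A ∈ T.single M) :
    IsState A := by
  let fw : Framework R M := ⟨0, Fin.elim0, 1, one_pos⟩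
  have := (T.family fw).isState {Slot.sys} (Finset.singleton_nonempty _) _
    ((T.single_sys fw A).2 hA)
  exact (isState_lift_iff (fw := fw) Slot.sys A).1 this

variable (T M) in
theorem isClosed_single : IsClosed (T.single M) := by
  let fw : Framework R M := ⟨0, Fin.elim0, 1, one_pos⟩
  have hcont : Continuous (lift (fw := fw) Slot.sys) := by
    change Continuous fun A : Matrix (fw.Space Slot.sys) (fw.Space Slot.sys) ℂ =>
      A.submatrix (singleEquiv Slot.sys) (singleEquiv Slot.sys)
    fun_prop
  have hpre : T.single M = lift (fw := fw) Slot.sys ⁻¹' (T.family fw).free {Slot.sys} :=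
    Set.ext fun A => (T.single_sys fw A).symm
  rw [hpre]
  exact ((T.family fw).closed _ (Finset.singleton_nonempty _)).preimage hcont

theorem submatrix_mem_single {A : fw.Op {Slot.sys}} (hA : A ∈ (T.family fw).free {Slot.sys}) :
    A.submatrix (singleEquiv Slot.sys).symm (singleEquiv Slot.sys).symm ∈ T.single M := by
  rw [← T.single_sys fw, lift_submatrix_symm]
  exact hA

theorem one_mem_freeOps (L : Finset (Slot fw.m)) : 1 ∈ (T.family fw).freeOps L :=
  ⟨one_mem _, fun σ hσ => by simpa using hσ, fun σ hσ => by simpa using hσ⟩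

theorem mul_mem_freeOps {L : Finset (Slot fw.m)} {U V : fw.Op L}
    (hU : U ∈ (T.family fw).freeOps L) (hV : V ∈ (T.family fw).freeOps L) :
    U * V ∈ (T.family fw).freeOps L := by
  refine ⟨mul_mem hU.1 hV.1, fun σ hσ => ?_, fun σ hσ => ?_⟩
  · have := hU.2.1 _ (hV.2.1 σ hσ)
    rw [conjTranspose_mul]
    simpa only [Matrix.mul_assoc] using this
  · have := hV.2.2 _ (hU.2.2 σ hσ)
    rw [conjTranspose_mul]
    simpa only [Matrix.mul_assoc] using this

theorem conjTranspose_mem_freeOps {L : Finset (Slot fw.m)} {U : fw.Op L}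
    (hU : U ∈ (T.family fw).freeOps L) : Uᴴ ∈ (T.family fw).freeOps L :=
  ⟨Unitary.star_mem hU.1, fun σ hσ => by simpa using hU.2.2 σ hσ,
    fun σ hσ => by simpa using hU.2.1 σ hσ⟩

theorem controlled_mem_free (hPC : T.PerfectlyCorrelated fw) {σ : fw.Op fw.ME}
    (hσ : σ ∈ (T.family fw).free fw.ME) :
    (fw.ell : ℝ)⁻¹ • fw.controlled (fun _ => σ) ∈ (T.family fw).free Finset.univ := by
  rw [hPC.free_eq]
  refine subset_convexHull _ _ ⟨σ, hσ, fun _ => 1, fun _ => one_mem_freeOps _, ?_⟩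
  simp

/-- The vanishing of an entry is a linear condition that holds on the generators of the convex hull.
-/
theorem apply_eq_zero_of_free (hPC : T.PerfectlyCorrelated fw) {ω : fw.Op Finset.univ}
    (hω : ω ∈ (T.family fw).free Finset.univ) {x y : fw.Idx Finset.univ} (h : ¬ InBlock x y) :
    ω x y = 0 := by
  rw [hPC.free_eq] at hω
  refine convexHull_min (t := {ω : fw.Op Finset.univ | ω x y = 0}) ?_ ?_ hω
  · rintro _ ⟨σ, -, U, -, rfl⟩
    simp [controlled_apply_eq_zero _ h]
  · intro A hA B hB a b _ _ _
    simp only [Set.mem_ofPred_eq] at hA hB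
    simp [hA, hB]

/-- Free states of `E J₁ ⋯ J_t` are classical on the last register. -/
theorem apply_restr_eq_zero_of_free (hPC : T.PerfectlyCorrelated fw) {σ : fw.Op {Slot.sys}}
    (hσ : σ ∈ (T.family fw).free {Slot.sys}) {μ : fw.Op fw.EJ}
    (hμ : μ ∈ (T.family fw).free fw.EJ) {x y : fw.Idx Finset.univ} (h : ¬ InBlock x y) :
    μ (restr (Finset.subset_univ fw.EJ) x) (restr (Finset.subset_univ fw.EJ) y) = 0 := by
  -- Tensoring `μ` with a free state of `M` gives a global free state, to which the convex hull
  -- description applies. A nonzero diagonal entry of `σ` is then divided out.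
  have hmem := (T.family fw).tensor_mem {Slot.sys} fw.EJ Finset.univ (Finset.subset_univ _)
    (Finset.subset_univ _) (Finset.singleton_nonempty _) ⟨Slot.rand, by simp⟩
    (by simp) (by ext s; simp) σ hσ μ hμ
  have htr := ((T.family fw).isState _ (Finset.singleton_nonempty _) σ hσ).2
  obtain ⟨a, -, ha⟩ : ∃ a ∈ Finset.univ, σ a a ≠ 0 :=
    Finset.exists_ne_zero_of_sum_ne_zero (by
      change σ.trace ≠ 0
      rw [htr]; exact one_ne_zero)
  let r : fw.Idx Finset.univ → fw.Idx Finset.univ := fun x s =>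
    if hs : s.1 ∈ ({Slot.sys} : Finset (Slot fw.m)) then a ⟨s.1, hs⟩ else x s
  have hr1 : ∀ x, restr (Finset.subset_univ {Slot.sys}) (r x) = a := by
    intro x
    funext s
    simp only [restr, r]
    rw [dif_pos s.2]
  have hr2 : ∀ x, restr (Finset.subset_univ fw.EJ) (r x) =
      restr (Finset.subset_univ fw.EJ) x := by
    intro x
    funext s
    simp only [restr, r]
    rw [dif_neg (Finset.mem_compl.1 s.2)]
  have h0 : ¬ InBlock (r x) (r y) := fun ⟨k, hx, hy⟩ =>
    h ⟨k, by simpa [r] using hx, by simpa [r] using hy⟩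
  have h1 := apply_eq_zero_of_free hPC hmem h0
  rw [tensor, of_apply, hr1, hr1, hr2, hr2] at h1
  exact (mul_eq_zero.1 h1).resolve_left ha

/-- The candidate for the smoothed state is the marginal on `M` of `U† (⊕ σ'_k) U`, and the
dominating free state is the marginal of `U†` applied to `σ_ME` with uniform shared randomness. -/
theorem minDmax_le_logb_ell (ht : 1 ≤ t) {ρ : Matrix (R.Basis M) (R.Basis M) ℂ}
    (hρ : IsState ρ) {ε : ℝ} (hPC : T.PerfectlyCorrelated fw) {μ : fw.Op fw.EJ}
    {U : fw.Op Finset.univ} {σ : fw.Op fw.ME} (h : T.IsTransformation fw ρ ε μ U σ) :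
    minDmax ε ρ (T.single M) ≤ (Real.logb 2 (fw.ell : ℝ) : EReal) := by
  have hell : (0 : ℝ) < fw.ell := Nat.cast_pos.2 fw.ell_pos
  have hME : fw.ME.Nonempty := ⟨Slot.sys, by simp⟩
  have hsysME : ({Slot.sys} : Finset (Slot fw.m)) ⊆ fw.ME := by simp
  obtain ⟨V, -, hUV⟩ := h.U_controlled
  have hU1 : Uᴴ * U = 1 := (Unitary.mem_iff.1 h.U_mem.1).1
  have hU2 : U * Uᴴ = 1 := (Unitary.mem_iff.1 h.U_mem.1).2
  have hσ := (T.family fw).isState _ hME σ h.σ_mem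
  have hσ0 := nonneg_iff_posSemidef.2 hσ.1
  have hμ := (T.family fw).isState fw.EJ ⟨Slot.rand, by simp⟩ μ h.μ_mem
  set ω : fw.Op Finset.univ := tensor (Finset.subset_univ _) (Finset.subset_univ _)
    (lift (fw := fw) Slot.sys ρ) μ with hω
  have hω0 : 0 ≤ ω := tensor_nonneg _ _ (Finset.compl_eq_univ_sdiff _)
    (nonneg_iff_posSemidef.2 ((isState_lift_iff (fw := fw) Slot.sys ρ).2 hρ).1)
    (nonneg_iff_posSemidef.2 hμ.1)
  have hωρ : ptrace {Slot.sys} ω = lift (fw := fw) Slot.sys ρ := by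
    rw [hω, ptrace_tensor _ _ (Finset.compl_eq_univ_sdiff _), hμ.2, one_smul]
  -- the final state is classical on the last register
  obtain ⟨A, hA0, hωc⟩ : ∃ A : Fin fw.ell → fw.Op fw.ME, (∀ k, 0 ≤ A k) ∧ ω = fw.controlled A :=
    ⟨_, fun k => nonneg_iff_posSemidef.2 ((nonneg_iff_posSemidef.1 hω0).submatrix _),
      -- The free state of `M` required here is the marginal of `σ`.
      eq_controlled ht fun x y hxy => by
        rw [hω, tensor, of_apply, apply_restr_eq_zero_of_free hPC
          ((T.family fw).ptrace_mem _ _ hsysME (Finset.singleton_nonempty _) σ h.σ_mem) h.μ_mem hxy,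
          mul_zero]⟩
  set Θ : Fin fw.ell → fw.Op fw.ME := fun k => V k * A k * (V k)ᴴ with hΘ
  have hΘ0 : ∀ k, 0 ≤ Θ k := fun k => conj_nonneg (hA0 k) _
  have hfinal : U * ω * Uᴴ = fw.controlled Θ := by
    -- The input is supported on the span of the `|k^t⟩`, the only subspace on which the form of `U`
    -- is prescribed.
    have hP : (fw.controlled fun _ => 1)ᴴ = fw.controlled fun _ => 1 := by
      rw [conjTranspose_controlled]; simp
    have hωP : fw.controlled (fun _ => 1) * ω * (fw.controlled fun _ => 1) = ω := by
      rw [hωc, controlled_mul ht, controlled_mul ht]; simp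
    calc U * ω * Uᴴ = (U * fw.controlled fun _ => 1) * ω * (U * fw.controlled fun _ => 1)ᴴ := by
          rw [conjTranspose_mul, hP]
          nth_rw 1 [← hωP]
          simp only [Matrix.mul_assoc]
      _ = fw.controlled V * fw.controlled A * (fw.controlled V)ᴴ := by rw [hUV, ← hωc]
      _ = fw.controlled Θ := by
          rw [conjTranspose_controlled, controlled_mul ht, controlled_mul ht]
  have hdist := h.dist_le
  rw [finalState, ← hω, hfinal, ptrace_controlled] at hdist
  set S := ∑ k, Θ k with hS
  have hS0 : 0 ≤ S := Finset.sum_nonneg fun k _ => hΘ0 k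
  -- a classical extension of `σ` as close to the final state as `σ` is to its marginal
  obtain ⟨B, hB, hBF⟩ := exists_re_trace_eq_fidelity S hσ0
  -- Since `√Θ_k = √S W_k`, the factors `B W_k` pair with the `√Θ_k` to the full fidelity: `∑ W_k
  -- W_k†` acts as the identity on the range of `√S`. Their sum of squares is at most `B B† ≤ σ`.
  obtain ⟨W, hW, hW1, hSW⟩ := exists_factors_of_sum_eq (S := CFC.sqrt S) (conjTranspose_sqrt S)
    (A := fun k => CFC.sqrt (Θ k)) (by
      rw [CFC.sqrt_mul_sqrt_self S hS0]
      exact Finset.sum_congr rfl fun k _ => sqrt_mul_conjTranspose_sqrt (hΘ0 k))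
  have hBW : ∑ k, (B * W k) * (B * W k)ᴴ ≤ σ := by
    have h1 := conj_mono hW1 B
    rw [Matrix.mul_one] at h1
    refine le_trans (le_of_eq ?_) (h1.trans hB)
    rw [Matrix.mul_sum, Matrix.sum_mul]
    refine Finset.sum_congr rfl fun k _ => ?_
    rw [conjTranspose_mul]
    simp only [Matrix.mul_assoc]
  -- The missing weight is spread evenly over the blocks, so that they sum to exactly `σ`.
  set D := (fw.ell : ℝ)⁻¹ • (σ - ∑ k, (B * W k) * (B * W k)ᴴ) with hD
  have hD0 : 0 ≤ D := smul_nonneg (by positivity) (sub_nonneg.2 hBW)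
  set σ' : Fin fw.ell → fw.Op fw.ME := fun k => (B * W k) * (B * W k)ᴴ + D with hσ'
  have hBσ' : ∀ k, (B * W k) * (B * W k)ᴴ ≤ σ' k := fun k => le_add_of_nonneg_right hD0
  have hσ'0 : ∀ k, 0 ≤ σ' k := fun k => (self_mul_conjTranspose_nonneg _).trans (hBσ' k)
  have hσ's : ∑ k, σ' k = σ := by
    rw [hσ', Finset.sum_add_distrib, Finset.sum_const, Finset.card_univ, Fintype.card_fin, hD,
      ← Nat.cast_smul_eq_nsmul ℝ, smul_smul, mul_inv_cancel₀ hell.ne', one_smul]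
    abel
  have hσ'σ : ∀ k, σ' k ≤ σ := by
    intro k
    rw [← hσ's]
    exact Finset.single_le_sum (f := σ') (fun k _ => hσ'0 k) (Finset.mem_univ k)
  have hF1 : fidelity S σ ≤ fidelity (fw.controlled Θ) (fw.controlled σ') := by
    refine le_trans (le_of_eq ?_) (sum_re_trace_le_fidelity_controlled ht
      (fun k => (sqrt_mul_conjTranspose_sqrt (hΘ0 k)).le) hBσ')
    rw [← hBF, ← Complex.re_sum, ← trace_sum]
    congr 2
    nth_rw 1 [← hSW]
    rw [Matrix.mul_sum, Matrix.sum_mul]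
    refine Finset.sum_congr rfl fun k _ => ?_
    rw [hW k, conjTranspose_mul]
    simp only [Matrix.mul_assoc]
  have hCσ' : IsState (fw.controlled σ') :=
    ⟨nonneg_iff_posSemidef.1 (controlled_nonneg ht hσ'0), by
      rw [trace_controlled, ← trace_sum, hσ's, hσ.2]⟩
  have hUh : Uᴴᴴ * Uᴴ = 1 := by rw [conjTranspose_conjTranspose, hU2]
  have hF2 := fidelity_le_fidelity_conj (controlled_nonneg ht hΘ0) (controlled_nonneg ht hσ'0) hUh
  have hback : Uᴴ * fw.controlled Θ * Uᴴᴴ = ω := by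
    rw [← hfinal, conjTranspose_conjTranspose]
    calc Uᴴ * (U * ω * Uᴴ) * U = (Uᴴ * U) * ω * (Uᴴ * U) := by simp only [Matrix.mul_assoc]
      _ = ω := by rw [hU1, Matrix.one_mul, Matrix.mul_one]
  rw [hback] at hF2
  set ξ := Uᴴ * fw.controlled σ' * Uᴴᴴ with hξ
  have hξs : IsState ξ := isState_conj hCσ' hUh
  have hξ0 := nonneg_iff_posSemidef.2 hξs.1
  have hF3 := fidelity_le_fidelity_ptrace (Finset.subset_univ {Slot.sys}) hω0 hξ0
  have hF4 := fidelity_le_fidelity_submatrix (ptrace_nonneg (K := {Slot.sys}) hω0)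
    (ptrace_nonneg (K := {Slot.sys}) hξ0) (singleEquiv Slot.sys).symm
  nth_rw 2 [hωρ] at hF4
  rw [lift_submatrix_symm'] at hF4
  -- the bound by a free state
  have hfree := h.U_mem.2.2 _ (controlled_mem_free hPC h.σ_mem)
  have hfree' := submatrix_mem_single ((T.family fw).ptrace_mem {Slot.sys} Finset.univ
    (Finset.subset_univ _) (Finset.singleton_nonempty _) _ hfree)
  refine minDmax_le hfree' (isState_submatrix (isState_ptrace (Finset.subset_univ _) hξs)
    (singleEquiv Slot.sys).symm)
    ((purifiedDist_anti (hF1.trans (hF2.trans (hF3.trans hF4)))).trans hdist) ?_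
  rw [Real.rpow_logb two_pos (by norm_num) hell]
  -- Each block is at most `σ`, whereas the free state has blocks `σ / ℓ`; this loss is the factor
  -- `ℓ`.
  have hle : ξ ≤ (fw.ell : ℝ) • (Uᴴ * ((fw.ell : ℝ)⁻¹ • fw.controlled fun _ => σ) * U) := by
    rw [Matrix.mul_smul, Matrix.smul_mul, smul_smul, mul_inv_cancel₀ hell.ne', one_smul]
    have := conj_mono (controlled_mono ht hσ'σ) Uᴴ
    rwa [← hξ, conjTranspose_conjTranspose] at this
  have := submatrix_mono (ptrace_mono (K := {Slot.sys}) hle) (singleEquiv Slot.sys).symm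
  rw [ptrace_smul] at this
  exact this

end ResourceTheory

/-! ### Permutation matrices -/

section PermMatrix

variable {n : Type*} [Fintype n] [DecidableEq n]

theorem one_submatrix_conj (e : n ≃ n) (A : Matrix n n ℂ) :
    (1 : Matrix n n ℂ).submatrix e id * A * ((1 : Matrix n n ℂ).submatrix e id)ᴴ =
      A.submatrix e e := by
  ext x y
  simp [mul_apply, one_apply]

theorem one_submatrix_mem_unitary (e : n ≃ n) :
    (1 : Matrix n n ℂ).submatrix e id ∈ unitaryGroup n ℂ := by
  rw [mem_unitaryGroup_iff, star_eq_conjTranspose]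
  have := one_submatrix_conj e 1
  rwa [Matrix.mul_one, submatrix_one_equiv] at this

theorem conjTranspose_one_submatrix {n : Type*} [DecidableEq n] {e : n ≃ n} (he : Function.Involutive e) :
    ((1 : Matrix n n ℂ).submatrix e id)ᴴ = (1 : Matrix n n ℂ).submatrix e id := by
  ext x y
  simp only [conjTranspose_apply, submatrix_apply, id, one_apply]
  have : e y = x ↔ e x = y := ⟨fun h => by rw [← h, he], fun h => by rw [← h, he]⟩
  by_cases h : e x = y <;> simp [h, this]

end PermMatrix

/-! ### Product operators, controlled unitaries and copies of one register -/

namespace Framework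

variable {t : ℕ} {R : RegisterSystem.{u} t} {M : R.Kind} {fw : Framework R M}
  {K L N : Finset (Slot fw.m)}

/-! Product operators -/

/-- The product of one operator for each register in `L`. -/
def regOp (A : ∀ s, Matrix (fw.Space s) (fw.Space s) ℂ) (L : Finset (Slot fw.m)) : fw.Op L :=
  piOp fun s : L => A s

theorem regOp_congr {A B : ∀ s, Matrix (fw.Space s) (fw.Space s) ℂ} (h : ∀ s ∈ L, A s = B s) :
    regOp A L = regOp B L :=
  congrArg piOp (funext fun s => h s s.2)

theorem isState_regOp {A : ∀ s, Matrix (fw.Space s) (fw.Space s) ℂ} (h : ∀ s, IsState (A s)) :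
    IsState (regOp A L) :=
  isState_piOp fun s => h s

theorem regOp_singleton (A : ∀ s, Matrix (fw.Space s) (fw.Space s) ℂ) (s : Slot fw.m) :
    regOp A {s} = lift s (A s) := by
  ext x y
  rw [regOp, piOp_apply]
  exact Fintype.prod_unique (ι := ({s} : Finset (Slot fw.m))) _

theorem tensor_regOp (A : ∀ s, Matrix (fw.Space s) (fw.Space s) ℂ) (hK : K ⊆ N) (hL : L ⊆ N)
    (hd : Disjoint K L) (hN : K ∪ L = N) :
    tensor hK hL (regOp A K) (regOp A L) = regOp A N := by
  ext x y
  let g : Slot fw.m → ℂ := fun s => if h : s ∈ N then A s (x ⟨s, h⟩) (y ⟨s, h⟩) else 1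
  have key : ∀ (K : Finset (Slot fw.m)) (hK : K ⊆ N),
      regOp A K (restr hK x) (restr hK y) = ∏ s ∈ K, g s := by
    intro K hK
    rw [regOp, piOp_apply, ← Finset.prod_coe_sort K g]
    refine Fintype.prod_congr _ _ fun s => ?_
    simp only [g, dif_pos (hK s.2)]
    rfl
  have hx : regOp A N x y = ∏ s ∈ N, g s := key N subset_rfl
  rw [tensor, of_apply, key, key, hx, ← hN, Finset.prod_union hd]

variable (fw) in
/-- The maximally correlated classical state of the last register. -/
def correlated : Matrix (fw.Space Slot.rand) (fw.Space Slot.rand) ℂ :=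
  (fw.ell : ℝ)⁻¹ • ∑ k : Fin fw.ell, Matrix.single (fun _ => k) (fun _ => k) 1

variable (fw) in
theorem isState_correlated : IsState fw.correlated := by
  have : Nonempty (Fin fw.ell) := ⟨⟨0, fw.ell_pos⟩⟩
  have h := isState_average (ι := Fin fw.ell) (A := fun k =>
    (Matrix.single (fun _ => k) (fun _ => k) 1 :
      Matrix (fw.Space Slot.rand) (fw.Space Slot.rand) ℂ)) fun k =>
    ⟨by
      have := posSemidef_self_mul_conjTranspose (Matrix.single (fun _ => k) (fun _ => k) 1 :
        Matrix (fw.Space Slot.rand) (fw.Space Slot.rand) ℂ)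
      rwa [conjTranspose_single, single_mul_single_same, star_one, one_mul] at this,
    trace_single_eq_same _ _⟩
  rwa [Fintype.card_fin] at h

theorem regOp_univ_eq_controlled {A : ∀ s, Matrix (fw.Space s) (fw.Space s) ℂ}
    (hA : A Slot.rand = fw.correlated) :
    regOp A Finset.univ = (fw.ell : ℝ)⁻¹ • fw.controlled fun _ => regOp A fw.ME := by
  rw [← tensor_regOp A (Finset.subset_univ fw.ME) (Finset.subset_univ {Slot.rand})
    (by simp) (by ext s; simp), regOp_singleton, hA]
  ext x y
  simp only [controlled, tensor, of_apply, Matrix.smul_apply, Matrix.sum_apply, ketbra,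
    correlated, lift, submatrix_apply, ← Finset.mul_sum, mul_smul_comm]

/-! Controlled unitaries -/

variable (fw) in
/-- The operator that acts as `V k` if the last register is in the state `k^t`, and trivially on the
complement of the span of these states. -/
def controlledUnitary (V : Fin fw.ell → fw.Op fw.ME) : fw.Op Finset.univ :=
  fw.controlled V + (1 - fw.controlled fun _ => 1)

theorem conjTranspose_controlledUnitary (V : Fin fw.ell → fw.Op fw.ME) :
    (fw.controlledUnitary V)ᴴ = fw.controlledUnitary fun k => (V k)ᴴ := by
  simp only [controlledUnitary, conjTranspose_add, conjTranspose_sub, conjTranspose_one,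
    conjTranspose_controlled]

theorem controlledUnitary_mul_controlled (ht : 1 ≤ t) (V A : Fin fw.ell → fw.Op fw.ME) :
    fw.controlledUnitary V * fw.controlled A = fw.controlled fun k => V k * A k := by
  simp only [controlledUnitary, Matrix.add_mul, Matrix.sub_mul, controlled_mul ht, Matrix.one_mul,
    sub_self, add_zero]

theorem controlled_mul_controlledUnitary (ht : 1 ≤ t) (V A : Fin fw.ell → fw.Op fw.ME) :
    fw.controlled A * fw.controlledUnitary V = fw.controlled fun k => A k * V k := by
  simp only [controlledUnitary, Matrix.mul_add, Matrix.mul_sub, controlled_mul ht, Matrix.mul_one,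
    sub_self, add_zero]

theorem controlledUnitary_conj (ht : 1 ≤ t) (V A : Fin fw.ell → fw.Op fw.ME) :
    fw.controlledUnitary V * fw.controlled A * (fw.controlledUnitary V)ᴴ =
      fw.controlled fun k => V k * A k * (V k)ᴴ := by
  rw [conjTranspose_controlledUnitary, controlledUnitary_mul_controlled ht,
    controlled_mul_controlledUnitary ht]

theorem controlledUnitary_mem_unitary (ht : 1 ≤ t) {V : Fin fw.ell → fw.Op fw.ME}
    (hV : ∀ k, V k ∈ unitaryGroup (fw.Idx fw.ME) ℂ) :
    fw.controlledUnitary V ∈ unitaryGroup (fw.Idx Finset.univ) ℂ := by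
  rw [mem_unitaryGroup_iff, star_eq_conjTranspose, conjTranspose_controlledUnitary]
  have h1 : ∀ k, V k * (V k)ᴴ = 1 := fun k => mem_unitaryGroup_iff.1 (hV k)
  nth_rw 2 [controlledUnitary]
  rw [Matrix.mul_add, Matrix.mul_sub, controlledUnitary_mul_controlled ht,
    controlledUnitary_mul_controlled ht, Matrix.mul_one, controlledUnitary]
  simp only [h1, Matrix.mul_one]
  abel

/-! Copies of one register -/

variable (M) in
/-- The framework whose registers other than the last are `n + 1` copies of `M`. -/
abbrev copies (n : ℕ) : Framework R M := ⟨n, fun _ => M, n + 1, n.succ_pos⟩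

/-- The operators `ρ` on the first copy, `σ` on the others, and the maximally correlated classical
state on the last register. -/
def copiesOp (n : ℕ) (ρ σ : Matrix (R.Basis M) (R.Basis M) ℂ) :
    ∀ s, Matrix ((copies M n).Space s) ((copies M n).Space s) ℂ
  | .sys => ρ
  | .cat _ => σ
  | .rand => (copies M n).correlated

theorem isState_copiesOp (n : ℕ) {ρ σ : Matrix (R.Basis M) (R.Basis M) ℂ} (hρ : IsState ρ)
    (hσ : IsState σ) : ∀ s, IsState (copiesOp n ρ σ s)
  | .sys => hρ
  | .cat _ => hσ
  | .rand => (copies M n).isState_correlated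

/-- Positions of the copies. -/
def copyEquiv (n : ℕ) : Option (Fin n) ≃ (copies M n).ME where
  toFun o := match o with
    | none => ⟨.sys, by simp⟩
    | some i => ⟨.cat i, by simp⟩
  invFun s := match s with
    | ⟨.sys, _⟩ => none
    | ⟨.cat i, _⟩ => some i
    | ⟨.rand, h⟩ => absurd h (by simp)
  left_inv o := by cases o <;> rfl
  right_inv s := by
    obtain ⟨s, h⟩ := s
    cases s with
    | sys => rfl
    | cat i => rfl
    | rand => exact absurd h (by simp)

/-- Labels on `n + 1` copies of `M` as families of labels of `M`. -/
def labelEquiv (n : ℕ) : (copies M n).Idx (copies M n).ME ≃ (Option (Fin n) → R.Basis M) where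
  toFun x o := match o with
    | none => x ⟨.sys, by simp⟩
    | some i => x ⟨.cat i, by simp⟩
  invFun f s := match s with
    | ⟨.sys, _⟩ => f none
    | ⟨.cat i, _⟩ => f (some i)
    | ⟨.rand, h⟩ => absurd h (by simp)
  left_inv x := by
    funext ⟨s, h⟩
    cases s with
    | sys => rfl
    | cat i => rfl
    | rand => exact absurd h (by simp)
  right_inv f := by
    funext o
    cases o <;> rfl

theorem regOp_copiesOp_ME (n : ℕ) (ρ σ : Matrix (R.Basis M) (R.Basis M) ℂ) :
    regOp (copiesOp n ρ σ) (copies M n).ME =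
      (piOp (Function.update (fun _ : Option (Fin n) => σ) none ρ)).submatrix
        (labelEquiv n) (labelEquiv n) := by
  ext x y
  rw [regOp, submatrix_apply, piOp_apply, piOp_apply]
  refine (Fintype.prod_equiv (copyEquiv n) _ _ fun o => ?_).symm
  cases o <;> rfl

/-- Interchange of the first copy and of the copy `o`. -/
def swapEquiv (n : ℕ) (o : Option (Fin n)) :
    (copies M n).Idx (copies M n).ME ≃ (copies M n).Idx (copies M n).ME :=
  (labelEquiv n).trans (((Equiv.swap none o).arrowCongr (Equiv.refl _)).trans (labelEquiv n).symm)

theorem labelEquiv_swapEquiv (n : ℕ) (o : Option (Fin n))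
    (x : (copies M n).Idx (copies M n).ME) :
    labelEquiv n (swapEquiv n o x) = labelEquiv n x ∘ Equiv.swap none o := by
  simp [swapEquiv, Equiv.arrowCongr]

theorem swapEquiv_involutive (n : ℕ) (o : Option (Fin n)) :
    Function.Involutive (swapEquiv (M := M) n o) := by
  intro x
  apply (labelEquiv n).injective
  rw [labelEquiv_swapEquiv, labelEquiv_swapEquiv]
  funext i
  simp

theorem regOp_copiesOp_swap (n : ℕ) (o : Option (Fin n)) (ρ σ : Matrix (R.Basis M) (R.Basis M) ℂ) :
    (regOp (copiesOp n ρ σ) (copies M n).ME).submatrix (swapEquiv n o) (swapEquiv n o) =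
      (piOp (Function.update (fun _ : Option (Fin n) => σ) o ρ)).submatrix
        (labelEquiv n) (labelEquiv n) := by
  rw [regOp_copiesOp_ME]
  ext x y
  simp only [submatrix_apply, piOp_apply, labelEquiv_swapEquiv]
  refine Fintype.prod_equiv (Equiv.swap none o) _ _ fun i => ?_
  have : Function.update (fun _ : Option (Fin n) => σ) none ρ i =
      Function.update (fun _ : Option (Fin n) => σ) o ρ (Equiv.swap none o i) := by
    by_cases hi : i = none
    · subst hi; simp
    · rw [Function.update_of_ne hi, Function.update_of_ne]
      intro h
      exact hi ((Equiv.swap none o).injective (by rw [h, Equiv.swap_apply_left]))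
  rw [this]
  rfl

/-- All registers but the last have the same kind, so the casts in the interchange are trivial. -/
theorem restr_swapIdx (n : ℕ) (j : Fin n) (h : ∀ i, R.dim ((copies M n).kind i) = R.dim M)
    (x : (copies M n).Idx Finset.univ) :
    restr (Finset.subset_univ (copies M n).ME) (swapIdx h j x) =
      swapEquiv n (some j) (restr (Finset.subset_univ (copies M n).ME) x) := by
  apply (labelEquiv n).injective
  rw [labelEquiv_swapEquiv]
  funext o
  cases o with
  | none =>
    simp only [Function.comp_apply, Equiv.swap_apply_left]
    rfl
  | some i =>
    by_cases hij : i = j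
    · subst hij
      simp only [Function.comp_apply, Equiv.swap_apply_right]
      simp only [labelEquiv, Equiv.coe_fn_mk, restr, swapIdx, if_true]
      rfl
    · rw [Function.comp_apply, Equiv.swap_apply_of_ne_of_ne (by simp) (by simpa using hij)]
      simp only [labelEquiv, Equiv.coe_fn_mk, restr, swapIdx, if_neg hij]

theorem controlled_submatrix_swapIdx (n : ℕ) (j : Fin n)
    (h : ∀ i, R.dim ((copies M n).kind i) = R.dim M) (A : (copies M n).Op (copies M n).ME) :
    ((copies M n).controlled fun _ => A).submatrix (swapIdx h j) (swapIdx h j) =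
      (copies M n).controlled fun _ =>
        A.submatrix (swapEquiv n (some j)) (swapEquiv n (some j)) := by
  have hr : ∀ x : (copies M n).Idx Finset.univ,
      restr (Finset.subset_univ {Slot.rand}) (swapIdx h j x) =
        restr (Finset.subset_univ {Slot.rand}) x := by
    intro x
    funext ⟨s, hs⟩
    obtain rfl := Finset.mem_singleton.1 hs
    rfl
  ext x y
  simp only [controlled, submatrix_apply, Matrix.sum_apply, tensor, of_apply, restr_swapIdx, hr]

end Framework

/-! ### The protocol for achievability -/

namespace ResourceTheory

open Framework

variable {t : ℕ} {R : RegisterSystem.{u} t} {T : ResourceTheory R} {M : R.Kind}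
  {fw : Framework R M}

theorem regOp_mem_free {A : ∀ s, Matrix (fw.Space s) (fw.Space s) ℂ} {L : Finset (Slot fw.m)}
    (hL : L.Nonempty) (h : ∀ s ∈ L, lift s (A s) ∈ (T.family fw).free {s}) :
    regOp A L ∈ (T.family fw).free L := by
  induction hL using Finset.Nonempty.cons_induction with
  | singleton s =>
    rw [regOp_singleton]
    exact h s (Finset.mem_singleton_self s)
  | cons s L hs hL ih =>
    rw [← tensor_regOp A (K := {s}) (L := L) (by simp) (by simp) (by simpa using hs)
      (by rw [Finset.cons_eq_insert, Finset.insert_eq])]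
    refine (T.family fw).tensor_mem _ _ _ _ _ (Finset.singleton_nonempty _) hL (by simpa using hs)
      (by rw [Finset.cons_eq_insert, Finset.insert_eq]) _ ?_ _
      (ih fun r hr => h r (Finset.mem_cons_of_mem hr))
    rw [regOp_singleton]
    exact h s (Finset.mem_cons_self s L)

/-- On a generator the conjugation replaces `U_k` by `V_k U_k`, which gives another generator;
convexity does the rest. -/
theorem controlledUnitary_conj_mem_free (ht : 1 ≤ t) (hPC : T.PerfectlyCorrelated fw)
    {V : Fin fw.ell → fw.Op fw.ME} (hV : ∀ k, V k ∈ (T.family fw).freeOps fw.ME)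
    {ω : fw.Op Finset.univ} (hω : ω ∈ (T.family fw).free Finset.univ) :
    fw.controlledUnitary V * ω * (fw.controlledUnitary V)ᴴ ∈
      (T.family fw).free Finset.univ := by
  rw [hPC.free_eq] at hω
  refine convexHull_min (t := {ω | fw.controlledUnitary V * ω * (fw.controlledUnitary V)ᴴ ∈
    (T.family fw).free Finset.univ}) ?_ ?_ hω
  · rintro _ ⟨σ, hσ, U, hU, rfl⟩
    rw [Set.mem_ofPred_eq, hPC.free_eq]
    refine subset_convexHull _ _ ⟨σ, hσ, fun k => V k * U k,
      fun k => mul_mem_freeOps (hV k) (hU k), ?_⟩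
    rw [Matrix.mul_smul, Matrix.smul_mul, controlledUnitary_conj ht]
    simp only [conjTranspose_mul, Matrix.mul_assoc]
  · intro A hA B hB a b ha hb hab
    have := (T.family fw).convex _ ⟨Slot.sys, Finset.mem_univ _⟩ hA hB ha hb hab
    rw [Set.mem_ofPred_eq]
    simpa only [Matrix.mul_add, Matrix.add_mul, Matrix.mul_smul, Matrix.smul_mul] using this

theorem controlledUnitary_mem_freeOps (ht : 1 ≤ t) (hPC : T.PerfectlyCorrelated fw)
    {V : Fin fw.ell → fw.Op fw.ME} (hV : ∀ k, V k ∈ (T.family fw).freeOps fw.ME) :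
    fw.controlledUnitary V ∈ (T.family fw).freeOps Finset.univ := by
  refine ⟨controlledUnitary_mem_unitary ht fun k => (hV k).1,
    fun σ hσ => controlledUnitary_conj_mem_free ht hPC hV hσ, fun σ hσ => ?_⟩
  have := controlledUnitary_conj_mem_free ht hPC (fun k => conjTranspose_mem_freeOps (hV k)) hσ
  rwa [← conjTranspose_controlledUnitary, conjTranspose_conjTranspose] at this

/-- Invariance under interchange is assumed for global free states only. Hence uniform shared
randomness is appended to `σ`, the interchange is made globally, and the last register is traced
out. -/
theorem submatrix_swapEquiv_mem_free {n : ℕ} (hPC : T.PerfectlyCorrelated (copies M n))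
    (o : Option (Fin n)) {σ : (copies M n).Op (copies M n).ME}
    (hσ : σ ∈ (T.family (copies M n)).free (copies M n).ME) :
    σ.submatrix (swapEquiv n o) (swapEquiv n o) ∈
      (T.family (copies M n)).free (copies M n).ME := by
  cases o with
  | none =>
    have : swapEquiv (M := M) n none = Equiv.refl _ := by
      ext1 x
      apply (labelEquiv n).injective
      rw [labelEquiv_swapEquiv]
      simp
    rw [this]
    simpa using hσ
  | some j =>
    have h1 := hPC.swap_mem (fun _ => rfl) (fun i A => Iff.rfl) j _ (controlled_mem_free hPC hσ)
    rw [submatrix_smul, Pi.smul_apply, Pi.smul_apply, controlled_submatrix_swapIdx] at h1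
    have h2 := (T.family (copies M n)).ptrace_mem _ _ (Finset.subset_univ (copies M n).ME)
      ⟨Slot.sys, by simp⟩ _ h1
    rw [ptrace_smul, ptrace_controlled, Finset.sum_const, Finset.card_univ, Fintype.card_fin,
      ← Nat.cast_smul_eq_nsmul ℝ, smul_smul, inv_mul_cancel₀ (by positivity), one_smul] at h2
    exact h2

theorem swap_mem_freeOps {n : ℕ} (hPC : T.PerfectlyCorrelated (copies M n)) (o : Option (Fin n)) :
    (1 : (copies M n).Op (copies M n).ME).submatrix (swapEquiv n o) id ∈
      (T.family (copies M n)).freeOps (copies M n).ME := by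
  have h1 : ∀ σ ∈ (T.family (copies M n)).free (copies M n).ME,
      (1 : (copies M n).Op (copies M n).ME).submatrix (swapEquiv n o) id * σ *
        ((1 : (copies M n).Op (copies M n).ME).submatrix (swapEquiv n o) id)ᴴ ∈
          (T.family (copies M n)).free (copies M n).ME := by
    intro σ hσ
    rw [one_submatrix_conj]
    exact submatrix_swapEquiv_mem_free hPC o hσ
  refine ⟨one_submatrix_mem_unitary _, h1, fun σ hσ => ?_⟩
  have h2 := h1 σ hσ
  rw [conjTranspose_one_submatrix (swapEquiv_involutive n o)] at h2 ⊢
  exact h2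

/-- Achievability with `n + 1` copies of the register. -/
theorem exists_catalytic_transformation (ht : 1 ≤ t) {n : ℕ}
    (hPC : T.PerfectlyCorrelated (copies M n)) {ρ ρ' σ : Matrix (R.Basis M) (R.Basis M) ℂ}
    (hρ : IsState ρ) (hρ' : IsState ρ') (hσ : σ ∈ T.single M) {ε δ x : ℝ}
    (hε : purifiedDist ρ ρ' ≤ ε) (hδ : 0 ≤ δ) (hx : 1 ≤ x) (h : ρ' ≤ x • σ)
    (hn : x - 1 ≤ δ ^ 2 * ((n + 1 : ℕ) + x - 1)) :
    ∃ (μ : (copies M n).Op (copies M n).EJ) (U : (copies M n).Op Finset.univ)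
      (τ : (copies M n).Op (copies M n).ME),
      T.IsTransformation (copies M n) ρ (ε + δ) μ U τ ∧ T.IsCatalytic (copies M n) μ τ := by
  have hσs := isState_of_mem_single hσ
  let A := copiesOp n σ σ
  have hAs : ∀ s, IsState (A s) := isState_copiesOp n hσs hσs
  have hτ : regOp A (copies M n).ME ∈ (T.family (copies M n)).free (copies M n).ME := by
    refine regOp_mem_free ⟨Slot.sys, by simp⟩ fun s hs => ?_
    cases s with
    | sys => exact (T.single_sys (copies M n) σ).2 hσ
    | cat i => exact (T.single_cat (copies M n) i σ).2 hσ
    | rand => exact absurd hs (by simp)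
  -- The correlated state of the last register is not assumed to be free; `μ` is free as a marginal
  -- of a global free state.
  have hμ : regOp A (copies M n).EJ ∈ (T.family (copies M n)).free (copies M n).EJ := by
    have h1 := controlled_mem_free hPC hτ
    rw [← regOp_univ_eq_controlled (A := A) rfl] at h1
    have h2 := (T.family (copies M n)).ptrace_mem _ _ (Finset.subset_univ (copies M n).EJ)
      ⟨Slot.rand, by simp⟩ _ h1
    rwa [← tensor_regOp A (Finset.subset_univ (copies M n).EJ) (Finset.subset_univ {Slot.sys})
      (by simp) (by ext s; simp), ptrace_tensor _ _ (by ext s; simp), (isState_regOp hAs).2,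
      one_smul] at h2
  -- The value `0` leaves the copies alone, and `i + 1` interchanges the first one with `cat i`.
  let V : Fin (n + 1) → (copies M n).Op (copies M n).ME := fun k =>
    (1 : (copies M n).Op (copies M n).ME).submatrix (swapEquiv n (finSuccEquiv n k)) id
  have hV : ∀ k, V k ∈ (T.family (copies M n)).freeOps (copies M n).ME :=
    fun k => swap_mem_freeOps hPC _
  refine ⟨regOp A (copies M n).EJ, (copies M n).controlledUnitary V, regOp A (copies M n).ME,
    ⟨hμ, controlledUnitary_mem_freeOps ht hPC hV, ⟨V, hV, ?_⟩, hτ, ?_⟩,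
    regOp A (copies M n).E, regOp A {Slot.rand}, σ, isState_regOp hAs, isState_regOp hAs, hσ,
    ?_, ?_⟩
  · rw [controlledUnitary_mul_controlled ht]
    simp only [Matrix.mul_one]
  · have hin : tensor (Finset.subset_univ {Slot.sys}) (Finset.subset_univ (copies M n).EJ)
        (lift (fw := copies M n) Slot.sys ρ) (regOp A (copies M n).EJ) =
          regOp (copiesOp n ρ σ) Finset.univ := by
      rw [← tensor_regOp (copiesOp n ρ σ) (Finset.subset_univ {Slot.sys})
        (Finset.subset_univ (copies M n).EJ) (by simp) (by ext s; simp), regOp_singleton]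
      congr 1
      refine regOp_congr fun s hs => ?_
      cases s with
      | sys => exact absurd hs (by simp)
      | cat i => rfl
      | rand => rfl
    have hout : ptrace (copies M n).ME (finalState (copies M n) ρ (regOp A (copies M n).EJ)
        ((copies M n).controlledUnitary V)) =
          (splitState (Option (Fin n)) ρ σ).submatrix (labelEquiv n) (labelEquiv n) := by
      rw [finalState, hin, regOp_univ_eq_controlled rfl, Matrix.mul_smul, Matrix.smul_mul,
        controlledUnitary_conj ht, ptrace_smul, ptrace_controlled]
      simp only [V, one_submatrix_conj, regOp_copiesOp_swap]
      rw [Equiv.sum_comp (finSuccEquiv n) fun o =>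
        (piOp (Function.update (fun _ : Option (Fin n) => σ) o ρ)).submatrix
          (labelEquiv n) (labelEquiv n)]
      ext x y
      simp [splitState, Matrix.sum_apply]
    have hprod : regOp A (copies M n).ME =
        (piOp fun _ : Option (Fin n) => σ).submatrix (labelEquiv n) (labelEquiv n) := by
      rw [regOp_copiesOp_ME, Function.update_eq_self_iff.2 rfl]
    rw [hout, hprod]
    refine (purifiedDist_anti (fidelity_le_fidelity_submatrix
      (nonneg_iff_posSemidef.2 (isState_splitState _ hρ hσs).1)
      (nonneg_iff_posSemidef.2 (isState_piOp fun _ => hσs).1) (labelEquiv n))).trans ?_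
    refine purifiedDist_splitState_le _ hρ hρ' hσs hε hδ hx h ?_
    rwa [Fintype.card_option, Fintype.card_fin]
  · exact (tensor_regOp A _ _ (by simp) (by ext s; cases s <;> simp)).symm
  · rw [← tensor_regOp A (K := {Slot.sys}) (L := (copies M n).E) (by simp)
      (by simp [Framework.E, Framework.ME]) (by simp) (by ext s; cases s <;> simp),
      regOp_singleton]
    rfl

end ResourceTheory

end CatalyticResource

end

theorem theorem3 {t : ℕ} (ht : 1 ≤ t) (R : RegisterSystem.{u} t) (T : ResourceTheory R)
    (M : R.Kind) (ρ : Matrix (R.Basis M) (R.Basis M) ℂ) (hρ : IsState ρ)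
    (ε δ : ℝ) (hε : 0 < ε) (hδ : 0 < δ) :
    -- the minimum is attained
    ((T.single M).Nonempty →
      ∃ σ ∈ T.single M, dmaxSmooth ε ρ σ = minDmax ε ρ (T.single M)) ∧
    -- achievability
    ((∀ fw : Framework R M, T.PerfectlyCorrelated fw) →
      ∀ k : ℝ, minDmax ε ρ (T.single M) = (k : EReal) →
        0 ≤ k + 2 * Real.logb 2 (1 / δ) →
        ∃ fw : Framework R M, fw.ell = ⌊(2 : ℝ) ^ (k + 2 * Real.logb 2 (1 / δ))⌋₊ ∧
          ∃ (μ : fw.Op fw.EJ) (U : fw.Op Finset.univ) (σ : fw.Op fw.ME),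
            T.IsTransformation fw ρ (ε + δ) μ U σ ∧ T.IsCatalytic fw μ σ) ∧
    -- converse
    (∀ fw : Framework R M, T.PerfectlyCorrelated fw →
      ∀ (μ : fw.Op fw.EJ) (U : fw.Op Finset.univ) (σ : fw.Op fw.ME),
        T.IsTransformation fw ρ ε μ U σ →
          minDmax ε ρ (T.single M) ≤ (Real.logb 2 (fw.ell : ℝ) : EReal)) := by
  refine ⟨exists_dmaxSmooth_eq_minDmax hε.le hρ (ResourceTheory.isClosed_single T M)
    fun _ => ResourceTheory.isState_of_mem_single, fun hPC k hk hpos => ?_,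
    fun fw hPC μ U σ h => ResourceTheory.minDmax_le_logb_ell ht hρ hPC h⟩
  obtain ⟨σ, hσ, ρ', hρ', hd, hc⟩ := exists_optimal hε.le hρ (ResourceTheory.isClosed_single T M)
    (fun _ => ResourceTheory.isState_of_mem_single) (hk.trans_lt (EReal.coe_lt_top k))
  have hle := hc k hk.le
  -- Comparing traces in `ρ' ≤ 2^k σ`.
  have hx1 : 1 ≤ (2 : ℝ) ^ k := by
    have := trace_re_mono hle
    rw [Matrix.trace_smul, hρ'.2, (ResourceTheory.isState_of_mem_single hσ).2] at this
    simpa using this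
  have hexp : (2 : ℝ) ^ (k + 2 * Real.logb 2 (1 / δ)) = (2 : ℝ) ^ k / δ ^ 2 := by
    rw [Real.rpow_add two_pos, mul_comm 2, Real.rpow_mul two_pos.le,
      Real.rpow_logb two_pos (by norm_num) (by positivity), Real.rpow_two]
    field_simp
  have hfloor : 1 ≤ ⌊(2 : ℝ) ^ (k + 2 * Real.logb 2 (1 / δ))⌋₊ := by
    rw [Nat.one_le_floor_iff]
    exact Real.one_le_rpow one_le_two hpos
  obtain ⟨n, hn⟩ := Nat.exists_eq_add_of_le' hfloor
  refine ⟨Framework.copies M n, hn.symm, ResourceTheory.exists_catalytic_transformation ht (hPC _) hρ hρ' hσ hd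
    hδ.le hx1 hle ?_⟩
  -- With `N` the floor and `x = 2^k` this gives `x < (N + 1) δ²`. If `δ ≤ 1`, then `x - 1 < N δ² +
  -- (δ² - 1) ≤ N δ²`, so rounding down costs nothing; if `δ ≥ 1`, already `x - 1 ≤ δ² (x - 1)`.
  have hlt := Nat.lt_floor_add_one ((2 : ℝ) ^ (k + 2 * Real.logb 2 (1 / δ)))
  rw [hn, hexp, div_lt_iff₀ (by positivity)] at hlt
  generalize (2 : ℝ) ^ k = x at *
  have hn0 : (0 : ℝ) ≤ (n + 1 : ℕ) := Nat.cast_nonneg _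
  generalize ((n + 1 : ℕ) : ℝ) = N at *
  have hδ2 : 0 < δ ^ 2 := by positivity
  rcases le_total (δ ^ 2) 1 with h1 | h1
  · nlinarith [mul_nonneg hδ2.le (sub_nonneg.2 hx1)]
  · nlinarith [mul_nonneg hδ2.le hn0, mul_nonneg (sub_nonneg.2 h1) (sub_nonneg.2 hx1)]
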